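/- Let $T=(V,E)$ be a finite tree with $p=|V|\ge 2$ vertices. Let $\mathbf C=[c_{i,j}]_{i,j\in V}$ be a real symmetric matrix with $c_i:=c_{i,i}>0$ for every $i\in V$, $c_{i,j}>0$ whenever $\{i,j\}\in E$, and $c_{i,j}=0$ for all other pairs. For $r\in V$ direct $T$ from the root $r$ outwards; write $\mathfrak C_r(i)$ for the set of children of $i$ and $\mathfrak p_r(i)$ for the parent of $i\ne r$. Define $\Phi_r(s)=(s_{i,(r)})_{i\in V}$ recursively, starting from the vertices farthest from $r$, by $$s_{i,(r)}=s_i\prod_{j\in\mathfrak C_r(i)}\Bigl(1+\frac{c_{i,j}}{c_i}\,s_{j,(r)}\Bigr)$$ (an empty product being $1$). For $\alpha,\gamma>0$ and $\beta\in\mathbb R$ let $\mathcal G(\alpha,\gamma)$ and $\mathcal K(\alpha,\beta,\gamma)$ be the probability laws on $(0,\infty)$ with densities proportional to $x^{\alpha-1}e^{-\gamma x}$ and $x^{\alpha-1}(1+x)^{-(\alpha+\beta)}e^{-\gamma x}$ respectively. For $\mathbf a\in(0,\infty)^V$ and a matrix $\mathbf C$ as above let $\mathrm{TK}(\mathbf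 a,\mathbf C)$ be the probability law on $(0,\infty)^V$ with density proportional to $$\prod_{i\in V}x_i^{a_i-1}\,\exp\Bigl(-\sum_{S\subseteq T}\ \prod_{i\in V(S)}\frac{x_i}{c_i^{\deg_S(i)-1}}\prod_{\{j,k\}\in E(S)}c_{j,k}\Bigr),$$ where the sum is over all (non-empty) subtrees $S$ of $T$. Let $\mathbf X=(X_i)_{i\in V}$ be a random vector whose law has a density that vanishes outside $(0,\infty)^V$ and is strictly positive and continuously differentiable on $(0,\infty)^V$. Suppose that for every leaf $r$ of $T$ (vertex of degree $1$) the components $X_{i,(r)}$, $i\in V$, of $\Phi_r(\mathbf X)$ are mutually independent. Then there exist $\mathbf a=(a_i)_{i\in V}\in(0,\infty)^V$ and $c>0$ such that for every $r\in V$ $$X_{r,(r)}\sim\mathcal G(a_r,\,c\,c_r),\qquad \frac{c_{\mathfrak p_r(i),i}}{c_{\mathfrak p_r(i)}}\,X_{i,(r)}\sim\mathcal K\Bigl(a_i,\;a_{\mathfrak p_r(i)}-a_i,\;c\,\frac{c_{\mathfrak p_r(i)}\,c_i}{c_{\mathfrak p_r(i),i}}\Bigr)\quad(i\in V\setminus\{r\}),$$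 and $\mathbf X\sim\mathrm{TK}(\mathbf a,c\,\mathbf C)$. -/

import Mathlib

open MeasureTheory ProbabilityTheory

noncomputable section

namespace TreeKummer

variable {V : Type*} [Fintype V]

/-- In the tree `T` directed away from the root `r`, the vertex `i` is the parent of `j`
(and `j` is a child of `i`): `{i, j}` is an edge and `j` is one step further from `r` than `i`. -/
def IsParent (T : SimpleGraph V) (r i j : V) : Prop :=
  T.Adj i j ∧ T.dist r j = T.dist r i + 1

/-- In a tree every vertex other than the root has exactly one parent. -/
theorem existsUnique_parent (T : SimpleGraph V) (hT : T.IsTree) (r i : V) (h : i ≠ r) :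
    ∃! j, IsParent T r j i := by
  obtain ⟨w, hw, hl⟩ := hT.connected.exists_path_of_dist i r
  cases w with
  | nil => exact absurd rfl h
  | @cons _ j _ hij w =>
    have e1 : T.dist r i = w.length + 1 := by rw [SimpleGraph.dist_comm, ← hl]; simp
    have := T.dist_le w
    have := hT.dist_eq_dist_add_one_of_adj r hij
    rw [SimpleGraph.dist_comm] at *
    refine ⟨j, ⟨hij.symm, ?_⟩, ?_⟩
    · have := T.dist_comm (u := j) (v := r); have := T.dist_comm (u := i) (v := r); omega
    · rintro k ⟨hk, hk2⟩
      obtain ⟨u, hu, hul⟩ := hT.connected.exists_path_of_dist k r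
      have hp : (SimpleGraph.Walk.cons hk.symm u).IsPath := by
        apply SimpleGraph.Walk.isPath_of_length_eq_dist
        rw [SimpleGraph.Walk.length_cons, hul, T.dist_comm, T.dist_comm (u := i), hk2]
      have := (hT.existsUnique_path i r).unique hp hw
      injection this

open Classical in
/-- The set of children of `i` in the tree `T` directed away from the root `r`. -/
def children (T : SimpleGraph V) (r i : V) : Finset V :=
  Finset.univ.filter (IsParent T r i)

/-- Matrices `C` with `C i i > 0`, `C i j = C j i > 0` on edges, and zero elsewhere. -/
structure IsParam (T : SimpleGraph V) (C : Matrix V V ℝ) : Prop where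
  symm : C.IsSymm
  diag_pos : ∀ i, 0 < C i i
  edge_pos : ∀ i j, T.Adj i j → 0 < C i j
  eq_zero : ∀ i j, i ≠ j → ¬ T.Adj i j → C i j = 0

/-- The `i`-th coordinate of the transformation with root `r`, defined recursively from the
vertices furthest from the root:
`s_{i,(r)} = s_i * ∏_{j child of i} (1 + (c_{i,j} / c_i) * s_{j,(r)})`. -/
def Phi (T : SimpleGraph V) (C : Matrix V V ℝ) (r : V) (s : V → ℝ) (i : V) : ℝ :=
  s i * ∏ j ∈ (children T r i).attach, (1 + C i j.1 / C i i * Phi T C r s j.1)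
termination_by Finset.univ.sup (T.dist r) - T.dist r i
decreasing_by
  have h : IsParent T r i j.1 := by simpa [children] using j.2
  have h1 : T.dist r j.1 ≤ Finset.univ.sup (T.dist r) := Finset.le_sup (Finset.mem_univ _)
  have h2 := h.2
  omega

theorem Phi_eq (T : SimpleGraph V) (C : Matrix V V ℝ) (r : V) (s : V → ℝ) (i : V) :
    Phi T C r s i = s i * ∏ j ∈ children T r i, (1 + C i j / C i i * Phi T C r s j) := by
  rw [Phi, Finset.prod_attach (children T r i) (fun j => 1 + C i j / C i i * Phi T C r s j)]

/-- The open orthant `(0, ∞)^V`. -/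
def orthant (V : Type*) : Set (V → ℝ) := {x | ∀ i, 0 < x i}

/-- A measure rescaled to total mass one. -/
def normalize {α : Type*} [MeasurableSpace α] (m : Measure α) : Measure α :=
  (m Set.univ)⁻¹ • m

/-- The Kummer distribution `K(α, β, γ)` (for `α, γ > 0`), with density proportional to
`x ^ (α - 1) * (1 + x) ^ (-(α + β)) * exp (-γ x)` on `(0, ∞)`. -/
def kummerMeasure (α β γ : ℝ) : Measure ℝ :=
  normalize ((volume.restrict (Set.Ioi 0)).withDensity fun x =>
    ENNReal.ofReal (x ^ (α - 1) / (1 + x) ^ (α + β) * Real.exp (-(γ * x))))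

open Classical in
/-- The vertex sets of the subtrees of `T`: a subtree is an induced subgraph that is a tree. -/
def subtrees (T : SimpleGraph V) : Finset (Finset V) :=
  Finset.univ.filter fun U => (T.induce (U : Set V)).IsTree

open Classical in
/-- The degree of `i` in the subgraph of `T` induced on `U`. -/
def degIn (T : SimpleGraph V) (U : Finset V) (i : V) : ℕ :=
  (U.filter (T.Adj i)).card

open Classical in
/-- The edges of the subgraph of `T` induced on `U`. -/
def edgesIn (T : SimpleGraph V) (U : Finset V) : Finset (Sym2 V) :=
  T.edgeFinset.filter fun e => ∀ v ∈ e, v ∈ U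

/-- The entry `c_{j,k}` of a symmetric matrix at the unordered pair `{j, k}`. -/
def edgeWeight (C : Matrix V V ℝ) (hC : C.IsSymm) : Sym2 V → ℝ :=
  Sym2.lift ⟨fun j k => C j k, fun j k => hC.apply k j⟩

/-- The sum over subtrees `S` of `T` of
`∏_{i ∈ V(S)} x_i / c_i ^ (deg_S(i) - 1) * ∏_{{j,k} ∈ E(S)} c_{j,k}`. -/
def energy (T : SimpleGraph V) (C : Matrix V V ℝ) (hC : C.IsSymm) (x : V → ℝ) : ℝ :=
  ∑ U ∈ subtrees T, (∏ i ∈ U, x i / C i i ^ ((degIn T U i : ℤ) - 1)) *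
    ∏ e ∈ edgesIn T U, edgeWeight C hC e

/-- The tree-Kummer distribution `TK(a, C)`, with density proportional to
`∏_i x_i ^ (a_i - 1) * exp (-energy x)` on `(0, ∞)^V`. -/
def treeKummerMeasure (T : SimpleGraph V) (a : V → ℝ) (C : Matrix V V ℝ) (hC : C.IsSymm) :
    Measure (V → ℝ) :=
  normalize ((volume.restrict (orthant V)).withDensity fun x =>
    ENNReal.ofReal ((∏ i, x i ^ (a i - 1)) * Real.exp (-energy T C hC x)))

end TreeKummer

end

/-! Let `L = log f + ∑ log x_i`, the log-density with respect to `∏ dx_i / x_i`. On the orthant `Phi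
T C r` has the explicit inverse `Psi T C r`, with Jacobian determinant `∏ Psi_i / y_i`. So `L ∘ Psi
T C r` is, in the same sense, the log-density of the transformed vector, and independence makes it
additively separable (`isSeparable_of_iIndepFun`).

Take an edge `{p, q}`; both sides of it contain a leaf of `T`. Freeze all coordinates except `x_p,
x_q` and describe these by `u = Phi T C q x p` and `v = Phi T C p x q`. Put `k = c_{p,q} / c_p` and
`k' = c_{p,q} / c_q`. Separability for a leaf on the side of `p` gives `L = F (u (1 + k v)) + H v`,
and for a leaf on the side of `q` it gives `L = G u + K (v (1 + k' u))`. Equating the two is the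
functional equation behind the gamma/Kummer characterization; `functional_equation` shows `F' s = A
/ s - c k'` and `K' t = B / t - c k`. Only `F` and `K` may depend on the frozen coordinates, and `H`
already determines `A, B, c`, so these are constants. After rescaling `c`, this reads `x_p ∂_p L = A
- c c_p Phi T C p x p`, and connectedness of `T` makes `c` the same at all vertices
(`exists_gradient`).

On the other hand the energy equals `∑ c_i Phi T C r x i` for every root `r` (`energy_eq_sum_Phi`).
With root `p` only the term `i = p` involves `x_p`, whence `x_p ∂_p energy = c_p Phi T C p x p`.
Therefore `L = b + ∑ a_i log x_i - c energy`. In the coordinates of any root, leaf or not, this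
density is a product of a gamma and of Kummer densities, and finiteness of the gamma factor at each
root forces `a_r > 0` and `c > 0`. -/

noncomputable section

namespace TreeKummer

set_option linter.unusedSectionVars false

/-! ### The two-variable functional equation of gamma/Kummer type -/

section FunctionalEquation

open Filter Topology Set

/-- First boundary step for the two-variable functional equation: `t ψ(t)` has a limit at `0`. -/
theorem exists_limit_of_functional_equation {φ ψ g : ℝ → ℝ} (hφ : ContinuousOn φ (Ioi 0))
    (h : ∀ x y : ℝ, 0 < x → 0 < y → (1 + y) * φ (x * (1 + y)) = g x + y * ψ (y * (1 + x))) :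
    ∃ B, Tendsto (fun t => t * ψ t) (𝓝[>] 0) (𝓝 B) ∧ ∀ x, 0 < x → g x = φ x - B / (1 + x) := by
  -- With `y = t / (1 + x)` the argument of `ψ` in `h` is `t`, and `t → 0` sends `y` to `0` while
  -- `x` stays fixed. The limit of `t * ψ t` cannot depend on `x`, and this determines `g`.
  have key : ∀ x, 0 < x →
      Tendsto (fun t => t * ψ t) (𝓝[>] 0) (𝓝 ((1 + x) * (φ x - g x))) := by
    intro x hx
    have h1 : Tendsto (fun t : ℝ => t / (1 + x)) (𝓝[>] 0) (𝓝 0) := by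
      have : Tendsto (fun t : ℝ => t / (1 + x)) (𝓝 0) (𝓝 (0 / (1 + x))) :=
        tendsto_id.div_const _
      rw [zero_div] at this
      exact this.mono_left nhdsWithin_le_nhds
    have h2 : Tendsto (fun t : ℝ => φ (x * (1 + t / (1 + x)))) (𝓝[>] 0) (𝓝 (φ x)) := by
      have hc : ContinuousAt φ x := hφ.continuousAt (Ioi_mem_nhds hx)
      have : Tendsto (fun t : ℝ => x * (1 + t / (1 + x))) (𝓝[>] 0) (𝓝 (x * (1 + 0))) :=
        (h1.const_add 1).const_mul x
      rw [add_zero, mul_one] at this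
      exact hc.tendsto.comp this
    have h3 : Tendsto (fun t : ℝ =>
        (1 + x) * ((1 + t / (1 + x)) * φ (x * (1 + t / (1 + x))) - g x)) (𝓝[>] 0)
        (𝓝 ((1 + x) * ((1 + 0) * φ x - g x))) :=
      (((h1.const_add 1).mul h2).sub_const _).const_mul _
    rw [add_zero, one_mul] at h3
    refine h3.congr' ?_
    filter_upwards [self_mem_nhdsWithin] with t ht
    have ht : 0 < t := ht
    have hx1 : 0 < 1 + x := by linarith
    rw [h x (t / (1 + x)) hx (by positivity)]
    have e : t / (1 + x) * (1 + x) = t := by field_simp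
    rw [e]
    field_simp
    ring
  refine ⟨_, key 1 one_pos, fun x hx => ?_⟩
  have e := tendsto_nhds_unique (key 1 one_pos) (key x hx)
  have hx1 : 0 < 1 + x := by linarith
  rw [e]
  field_simp
  ring

/-- Second boundary step: behaviour at infinity. -/
theorem tendsto_atTop_of_functional_equation {φ ψ : ℝ → ℝ} {A B : ℝ}
    (hA : Tendsto (fun t => t * φ t) (𝓝[>] 0) (𝓝 A))
    (h : ∀ x y : ℝ, 0 < x → 0 < y → (1 + x + y) * φ (x * (1 + y)) =
      (1 + x) * φ x - B + y * ψ y - A * y / (1 + y)) (s : ℝ) (hs : 0 < s) :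
    Tendsto ψ atTop (𝓝 (φ s - A / s)) := by
  -- The choice `x = s / (1 + y)` keeps `x * (1 + y) = s` while `y → ∞` and `x → 0`. After division
  -- by `y`, the term in `φ x` survives only through the limit `A` of `x * φ x`.
  have hx : Tendsto (fun y : ℝ => s / (1 + y)) atTop (𝓝 0) :=
    (tendsto_atTop_add_const_left _ 1 tendsto_id).const_div_atTop s
  have hx' : Tendsto (fun y : ℝ => s / (1 + y)) atTop (𝓝[>] 0) := by
    rw [tendsto_nhdsWithin_iff]
    refine ⟨hx, ?_⟩
    filter_upwards [eventually_gt_atTop 0] with y hy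
    have : 0 < s / (1 + y) := by positivity
    exact this
  have hi : Tendsto (fun y : ℝ => 1 / y) atTop (𝓝 0) := tendsto_id.const_div_atTop 1
  have hxφ := hA.comp hx'
  -- `ψ y` expressed through the other terms
  have e : Tendsto (fun y : ℝ => (1 / y + s / (1 + y) * (1 / y) + 1) * φ s -
      (1 + s / (1 + y)) * (s / (1 + y) * φ (s / (1 + y))) * ((1 / y + 1) / s)
      + B * (1 / y) + A / (1 + y)) atTop
      (𝓝 ((0 + 0 * 0 + 1) * φ s - (1 + 0) * A * ((0 + 1) / s) + B * 0 + 0)) := by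
    refine Tendsto.add (Tendsto.add (Tendsto.sub ?_ ?_) ?_) ?_
    · exact (((hi.add (hx.mul hi)).add_const 1)).mul_const _
    · exact ((hx.const_add 1).mul hxφ).mul ((hi.add_const 1).div_const s)
    · exact hi.const_mul B
    · exact (tendsto_atTop_add_const_left _ 1 tendsto_id).const_div_atTop A
  have e2 : (0 + 0 * 0 + 1) * φ s - (1 + 0) * A * ((0 + 1) / s) + B * 0 + 0 = φ s - A / s := by
    ring
  rw [e2] at e
  refine e.congr' ?_
  filter_upwards [eventually_gt_atTop 0] with y hy
  have h1 := h (s / (1 + y)) y (by positivity) hy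
  have e3 : s / (1 + y) * (1 + y) = s := by field_simp
  rw [e3] at h1
  have e4 : ψ y = ((1 + s / (1 + y) + y) * φ s - (1 + s / (1 + y)) * φ (s / (1 + y)) + B
      + A * y / (1 + y)) / y := by
    rw [h1]; field_simp; ring
  rw [e4]
  generalize φ (s / (1 + y)) = z
  field_simp

/-- Solution of the two-variable functional equation at the level of derivatives. -/
theorem functional_equation_normalized {φ ψ g h : ℝ → ℝ} (hφ : ContinuousOn φ (Ioi 0))
    (hψ : ContinuousOn ψ (Ioi 0))
    (h₁ : ∀ x y : ℝ, 0 < x → 0 < y → (1 + y) * φ (x * (1 + y)) = g x + y * ψ (y * (1 + x)))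
    (h₂ : ∀ x y : ℝ, 0 < x → 0 < y → (1 + x) * ψ (y * (1 + x)) = h y + x * φ (x * (1 + y))) :
    ∃ A B c : ℝ, (∀ s, 0 < s → φ s = A / s - c) ∧ (∀ t, 0 < t → ψ t = B / t - c) ∧
      ∀ y, 0 < y → h y = B / y - A / (1 + y) - c := by
  obtain ⟨B, hB, hg⟩ := exists_limit_of_functional_equation hφ h₁
  obtain ⟨A, hA, hh⟩ := exists_limit_of_functional_equation (φ := ψ) (ψ := φ) (g := h) hψ
    (fun x y hx hy => h₂ y x hy hx)
  -- Eliminating `ψ (y * (1 + x))` between `h₁` and `h₂` leaves `φ (x * (1 + y))`, `φ x` and `ψ y`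
  -- only. The limit of `ψ` at infinity is then `φ s - A / s` for every `s`, so this difference is
  -- constant.
  have l1 := tendsto_atTop_of_functional_equation (B := B) hA (ψ := ψ) (fun x y hx hy => by
    have a1 := h₁ x y hx hy
    have a2 := h₂ x y hx hy
    rw [hg x hx] at a1
    rw [hh y hy] at a2
    have hx1 : 0 < 1 + x := by linarith
    have hy1 : 0 < 1 + y := by linarith
    have e1 : (1 + x + y) * φ (x * (1 + y)) =
      (1 + x) * ((1 + y) * φ (x * (1 + y))) - y * (x * φ (x * (1 + y))) := by ring
    have e2 : x * φ (x * (1 + y)) = (1 + x) * ψ (y * (1 + x)) - (ψ y - A / (1 + y)) := by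
      linarith
    rw [e1, a1, e2]
    field_simp
    ring)
  have l2 := tendsto_atTop_of_functional_equation (B := A) hB (ψ := φ) (fun y x hy hx => by
    have a1 := h₁ x y hx hy
    have a2 := h₂ x y hx hy
    rw [hg x hx] at a1
    rw [hh y hy] at a2
    have hx1 : 0 < 1 + x := by linarith
    have hy1 : 0 < 1 + y := by linarith
    have e1 : (1 + y + x) * ψ (y * (1 + x)) =
      (1 + y) * ((1 + x) * ψ (y * (1 + x))) - x * (y * ψ (y * (1 + x))) := by ring
    have e2 : y * ψ (y * (1 + x)) = (1 + y) * φ (x * (1 + y)) - (φ x - B / (1 + x)) := by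
      linarith
    rw [e1, a2, e2]
    field_simp
    ring)
  have c1 : ∀ s, 0 < s → φ s = A / s - (A - φ 1) := fun s hs => by
    have := tendsto_nhds_unique (l1 s hs) (l1 1 one_pos)
    rw [div_one] at this
    linarith
  have c2 : ∀ s, 0 < s → ψ s = B / s - (B - ψ 1) := fun s hs => by
    have := tendsto_nhds_unique (l2 s hs) (l2 1 one_pos)
    rw [div_one] at this
    linarith
  -- At infinity `φ` tends to `-(A - φ 1)` by its formula and to `ψ 1 - B` by `l2`.
  have c3 : A - φ 1 = B - ψ 1 := by
    have h3 : Tendsto φ atTop (𝓝 (0 - (A - φ 1))) := by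
      refine Tendsto.congr' ?_ ((tendsto_id.const_div_atTop A).sub_const (A - φ 1))
      filter_upwards [eventually_gt_atTop 0] with s hs
      exact (c1 s hs).symm
    have := tendsto_nhds_unique h3 (l2 1 one_pos)
    rw [div_one] at this
    linarith
  refine ⟨A, B, A - φ 1, c1, fun t ht => by rw [c2 t ht, c3], fun y hy => ?_⟩
  rw [hh y hy, c2 y hy, c3]
  ring

/-- The two-variable functional equation behind the gamma/Kummer characterization. -/
theorem functional_equation {F G H K : ℝ → ℝ} {k k' : ℝ} (hk : 0 < k) (hk' : 0 < k')
    (hF : ContDiffOn ℝ 1 F (Ioi 0)) (hG : DifferentiableOn ℝ G (Ioi 0))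
    (hH : DifferentiableOn ℝ H (Ioi 0)) (hK : ContDiffOn ℝ 1 K (Ioi 0))
    (h : ∀ u v, 0 < u → 0 < v → F (u * (1 + k * v)) + H v = G u + K (v * (1 + k' * u))) :
    ∃ A B c : ℝ, (∀ s, 0 < s → deriv F s = A / s - c * k') ∧
      (∀ t, 0 < t → deriv K t = B / t - c * k) ∧
      ∀ v, 0 < v → deriv H v = B / v - A * k / (1 + k * v) - c * k := by
  have dF : ∀ s, 0 < s → HasDerivAt F (deriv F s) s := fun s hs =>
    ((hF.differentiableOn one_ne_zero).differentiableAt (Ioi_mem_nhds hs)).hasDerivAt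
  have dK : ∀ s, 0 < s → HasDerivAt K (deriv K s) s := fun s hs =>
    ((hK.differentiableOn one_ne_zero).differentiableAt (Ioi_mem_nhds hs)).hasDerivAt
  have dG : ∀ s, 0 < s → HasDerivAt G (deriv G s) s := fun s hs =>
    (hG.differentiableAt (Ioi_mem_nhds hs)).hasDerivAt
  have dH : ∀ s, 0 < s → HasDerivAt H (deriv H s) s := fun s hs =>
    (hH.differentiableAt (Ioi_mem_nhds hs)).hasDerivAt
  -- Differentiation in `u` removes `H`; differentiation in `v`, in `dv`, removes `G`.
  have du : ∀ u v, 0 < u → 0 < v → (1 + k * v) * deriv F (u * (1 + k * v)) =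
      deriv G u + k' * v * deriv K (v * (1 + k' * u)) := by
    intro u v hu hv
    have i1 : HasDerivAt (fun u : ℝ => u * (1 + k * v)) (1 * (1 + k * v)) u :=
      (hasDerivAt_id u).mul_const _
    have i2 : HasDerivAt (fun u : ℝ => v * (1 + k' * u)) (v * (k' * 1)) u :=
      (((hasDerivAt_id u).const_mul k').const_add 1).const_mul v
    have d1 := ((dF (u * (1 + k * v)) (by positivity)).comp u i1).add_const (H v)
    have d2 := (dG u hu).add ((dK (v * (1 + k' * u)) (by positivity)).comp u i2)
    have d3 := d1.unique (d2.congr_of_eventuallyEq (by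
      filter_upwards [Ioi_mem_nhds hu] with w hw
      exact h w v hw hv))
    linarith
  have dv : ∀ u v, 0 < u → 0 < v → (1 + k' * u) * deriv K (v * (1 + k' * u)) =
      deriv H v + k * u * deriv F (u * (1 + k * v)) := by
    intro u v hu hv
    have i1 : HasDerivAt (fun v : ℝ => v * (1 + k' * u)) (1 * (1 + k' * u)) v :=
      (hasDerivAt_id v).mul_const _
    have i2 : HasDerivAt (fun v : ℝ => u * (1 + k * v)) (u * (k * 1)) v :=
      (((hasDerivAt_id v).const_mul k).const_add 1).const_mul u
    have d1 := ((dF (u * (1 + k * v)) (by positivity)).comp v i2).add (dH v hv)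
    have d2 := ((dK (v * (1 + k' * u)) (by positivity)).comp v i1).const_add (G u)
    have d3 := d1.unique (d2.congr_of_eventuallyEq (by
      filter_upwards [Ioi_mem_nhds hv] with w hw
      exact h u w hu hw))
    linarith
  have cF : ContinuousOn (deriv F) (Ioi 0) :=
    hF.continuousOn_deriv_of_isOpen isOpen_Ioi le_rfl
  have cK : ContinuousOn (deriv K) (Ioi 0) :=
    hK.continuousOn_deriv_of_isOpen isOpen_Ioi le_rfl
  -- The substitution `x = k' * u`, `y = k * v` turns both constants into `1`.
  obtain ⟨A, B, c, r1, r2, r3⟩ := functional_equation_normalized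
    (φ := fun s => deriv F (s / k') / k') (ψ := fun t => deriv K (t / k) / k)
    (g := fun u => deriv G (u / k') / k') (h := fun v => deriv H (v / k) / k)
    (by
      refine (cF.comp (by fun_prop) ?_).div_const _
      intro s hs
      have hs : 0 < s := hs
      have : 0 < s / k' := by positivity
      exact this)
    (by
      refine (cK.comp (by fun_prop) ?_).div_const _
      intro s hs
      have hs : 0 < s := hs
      have : 0 < s / k := by positivity
      exact this)
    (fun x y hx hy => by
      have := du (x / k') (y / k) (by positivity) (by positivity)
      rw [mul_div_cancel₀ _ hk.ne', mul_div_cancel₀ _ hk'.ne', div_mul_eq_mul_div,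
        div_mul_eq_mul_div] at this
      rw [← mul_div_assoc, this]
      field_simp)
    (fun x y hx hy => by
      have := dv (x / k') (y / k) (by positivity) (by positivity)
      rw [mul_div_cancel₀ _ hk.ne', mul_div_cancel₀ _ hk'.ne', div_mul_eq_mul_div,
        div_mul_eq_mul_div] at this
      rw [← mul_div_assoc, this]
      field_simp)
  refine ⟨A, B, c, fun s hs => ?_, fun t ht => ?_, fun v hv => ?_⟩
  · have := r1 (s * k') (by positivity)
    simp only [mul_div_cancel_right₀ _ hk'.ne'] at this
    field_simp at this ⊢
    linarith
  · have := r2 (t * k) (by positivity)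
    simp only [mul_div_cancel_right₀ _ hk.ne'] at this
    field_simp at this ⊢
    linarith
  · have := r3 (v * k) (by positivity)
    simp only [mul_div_cancel_right₀ _ hk.ne'] at this
    have e : deriv H v = k * (deriv H v / k) := by field_simp
    rw [e, this]
    have : 0 < 1 + v * k := by positivity
    have : 0 < 1 + k * v := by positivity
    field_simp

/-- The coefficients of a Kummer log-density derivative are determined by the function. -/
theorem coeff_unique {k A B c A' B' c' : ℝ} (hk : 0 < k)
    (h : ∀ v, 0 < v → B / v - A * k / (1 + k * v) - c * k =
      B' / v - A' * k / (1 + k * v) - c' * k) : A = A' ∧ B = B' ∧ c = c' := by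
  have key : ∀ n : ℝ, 0 < n → B / n - A / (1 + n) - c = B' / n - A' / (1 + n) - c' := by
    intro n hn
    have := h (n / k) (by positivity)
    rw [mul_div_cancel₀ _ hk.ne'] at this
    field_simp at this ⊢
    linarith
  -- The functions `1 / n`, `1 / (1 + n)` and `1` are linearly independent on `{1, 2, 3}`.
  have h1 := key 1 (by norm_num)
  have h2 := key 2 (by norm_num)
  have h3 := key 3 (by norm_num)
  norm_num at h1 h2 h3
  refine ⟨by linarith, by linarith, by linarith⟩

end FunctionalEquation

/-! ### Rooted trees, the transform and its inverse -/

section Combinatorics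

variable {V : Type*} [Fintype V] {T : SimpleGraph V} {C : Matrix V V ℝ}

theorem mem_children {r i j : V} : j ∈ children T r i ↔ IsParent T r i j := by
  simp [children]

theorem IsParent.ne {r i j : V} (h : IsParent T r i j) : i ≠ j := h.1.ne

theorem isParent_self {i j : V} (h : T.Adj i j) : IsParent T i i j :=
  ⟨h, by rw [SimpleGraph.dist_self, SimpleGraph.dist_eq_one_iff_adj.2 h]⟩

/-- Induction from the vertices farthest from the root. -/
theorem children_induction (r : V) {P : V → Prop}
    (h : ∀ i, (∀ j ∈ children T r i, P j) → P i) (i : V) : P i := by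
  suffices ∀ n, ∀ i, Finset.univ.sup (T.dist r) - T.dist r i = n → P i from this _ i rfl
  intro n
  induction n using Nat.strong_induction_on with
  | _ n ih =>
    intro i hi
    refine h i fun j hj => ih _ ?_ j rfl
    have h1 : T.dist r j ≤ Finset.univ.sup (T.dist r) := Finset.le_sup (Finset.mem_univ _)
    have h2 := (mem_children.1 hj).2
    omega

theorem mem_children_root {r j : V} : j ∈ children T r r ↔ T.Adj r j :=
  mem_children.trans ⟨fun h => h.1, isParent_self⟩

theorem IsParent.eq_left (hT : T.IsTree) {r i j l : V} (h : IsParent T r j i)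
    (h' : IsParent T r l i) : j = l := by
  have : i ≠ r := by
    rintro rfl
    have := h.2
    simp at this
  exact (existsUnique_parent T hT r i this).unique h h'

theorem isParent_or_isParent (hT : T.IsTree) (r : V) {i j : V} (h : T.Adj i j) :
    IsParent T r i j ∨ IsParent T r j i := by
  rcases hT.dist_eq_dist_add_one_of_adj r h with h1 | h1
  · exact Or.inr ⟨h.symm, h1⟩
  · exact Or.inl ⟨h, h1⟩

/-- Every neighbour is one step nearer to or farther from the root, and only the parent is nearer.
Hence the children depend on the root only through the parent. -/
theorem mem_children_of_isParent (hT : T.IsTree) {r i j l : V} (h : IsParent T r j i) :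
    l ∈ children T r i ↔ T.Adj i l ∧ l ≠ j := by
  rw [mem_children]
  constructor
  · intro hl
    refine ⟨hl.1, ?_⟩
    rintro rfl
    have := hl.2
    have := h.2
    omega
  · rintro ⟨h1, h2⟩
    rcases isParent_or_isParent hT r h1 with h3 | h3
    · exact h3
    · exact absurd (h3.eq_left hT h) h2

theorem children_congr (hT : T.IsTree) {r r' i j : V} (h : IsParent T r j i)
    (h' : IsParent T r' j i) : children T r i = children T r' i := by
  ext l
  rw [mem_children_of_isParent hT h, mem_children_of_isParent hT h']

/-- The transform at `i` depends on the root only through the edge from `i` towards the root. -/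
theorem Phi_congr_root (hT : T.IsTree) {r r' : V} (s : V → ℝ) (i : V) :
    ∀ j, IsParent T r j i → IsParent T r' j i → Phi T C r s i = Phi T C r' s i := by
  refine children_induction (T := T) r (P := fun i => ∀ j, IsParent T r j i → IsParent T r' j i →
    Phi T C r s i = Phi T C r' s i) ?_ i
  intro i ih j h h'
  rw [Phi_eq, Phi_eq T C r', children_congr hT h h']
  congr 1
  refine Finset.prod_congr rfl fun l hl => ?_
  rw [ih l (by rwa [children_congr hT h h']) i ?_ (mem_children.1 hl)]
  rw [← children_congr hT h h'] at hl
  exact mem_children.1 hl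

theorem Phi_eq_of_isParent (hT : T.IsTree) {r i j : V} (h : IsParent T r j i) (s : V → ℝ) :
    Phi T C r s i = Phi T C j s i :=
  Phi_congr_root hT s i j h (isParent_self h.1)

/-- The transform at `i` involves only vertices at least as far from the root as `i`. -/
theorem Phi_congr {r : V} {s s' : V → ℝ} (i : V)
    (h : ∀ l, T.dist r i ≤ T.dist r l → s l = s' l) : Phi T C r s i = Phi T C r s' i := by
  revert h
  refine children_induction (T := T) r (P := fun i =>
    (∀ l, T.dist r i ≤ T.dist r l → s l = s' l) → Phi T C r s i = Phi T C r s' i) ?_ i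
  intro i ih h
  rw [Phi_eq, Phi_eq T C r s', h i le_rfl]
  congr 1
  refine Finset.prod_congr rfl fun j hj => ?_
  rw [ih j hj fun l hl => h l ?_]
  have := (mem_children.1 hj).2
  omega

theorem coeff_pos (hC : IsParam T C) {i j : V} (h : T.Adj i j) : 0 < C i j / C i i :=
  div_pos (hC.edge_pos i j h) (hC.diag_pos i)

theorem prod_children_pos (hC : IsParam T C) {r i : V} {y : V → ℝ} (hy : y ∈ orthant V) :
    0 < ∏ j ∈ children T r i, (1 + C i j / C i i * y j) := by
  refine Finset.prod_pos fun j hj => ?_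
  have := mul_pos (coeff_pos hC (mem_children.1 hj).1) (hy j)
  linarith

theorem Phi_mem_orthant (hC : IsParam T C) (r : V) {s : V → ℝ} (hs : s ∈ orthant V) :
    Phi T C r s ∈ orthant V := by
  intro i
  refine children_induction (T := T) r (P := fun i => 0 < Phi T C r s i) ?_ i
  intro i ih
  rw [Phi_eq]
  refine mul_pos (hs i) (Finset.prod_pos fun j hj => ?_)
  have := mul_pos (coeff_pos hC (mem_children.1 hj).1) (ih j hj)
  linarith

/-- The inverse of `Phi T C r` on the open orthant. -/
def Psi (T : SimpleGraph V) (C : Matrix V V ℝ) (r : V) (y : V → ℝ) (i : V) : ℝ :=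
  y i / ∏ j ∈ children T r i, (1 + C i j / C i i * y j)

theorem Psi_mem_orthant (hC : IsParam T C) (r : V) {y : V → ℝ} (hy : y ∈ orthant V) :
    Psi T C r y ∈ orthant V :=
  fun i => div_pos (hy i) (prod_children_pos hC hy)

theorem Psi_Phi (hC : IsParam T C) (r : V) {s : V → ℝ} (hs : s ∈ orthant V) :
    Psi T C r (Phi T C r s) = s := by
  ext i
  rw [Psi, Phi_eq T C r s i]
  exact mul_div_cancel_right₀ _ (prod_children_pos hC (Phi_mem_orthant hC r hs)).ne'

theorem Phi_Psi (hC : IsParam T C) (r : V) {y : V → ℝ} (hy : y ∈ orthant V) :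
    Phi T C r (Psi T C r y) = y := by
  ext i
  refine children_induction (T := T) r (P := fun i => Phi T C r (Psi T C r y) i = y i) ?_ i
  intro i ih
  rw [Phi_eq, Finset.prod_congr rfl fun j hj => by rw [ih j hj], Psi]
  exact div_mul_cancel₀ _ (prod_children_pos hC hy).ne'

theorem continuous_Phi (r : V) : Continuous (Phi T C r) := by
  refine continuous_pi fun i => ?_
  refine children_induction (T := T) r (P := fun i => Continuous fun s => Phi T C r s i) ?_ i
  intro i ih
  simp only [Phi_eq T C r _ i]
  refine (continuous_apply i).mul (continuous_finsetProd _ fun j hj => ?_)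
  exact continuous_const.add (continuous_const.mul (ih j hj))

theorem orthant_eq_pi : orthant V = Set.pi Set.univ fun _ => Set.Ioi 0 := by
  ext x; simp [orthant]

theorem isOpen_orthant : IsOpen (orthant V) := by
  rw [orthant_eq_pi]
  exact isOpen_set_pi Set.finite_univ fun _ _ => isOpen_Ioi

theorem measurableSet_orthant : MeasurableSet (orthant V) := isOpen_orthant.measurableSet

/-- Every edge separates the tree into two parts, each of which contains a leaf of the tree. -/
theorem exists_leaf_isParent [DecidableRel T.Adj] (hT : T.IsTree) {p q : V} (h : T.Adj p q) :
    ∃ r, T.degree r = 1 ∧ IsParent T r p q := by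
  classical
  -- `r` is farthest from `q` on the side of `p`. A neighbour of `r` farther from `q` would still
  -- lie on that side, so the only neighbour is the one towards `q`.
  obtain ⟨r, hr, hmax⟩ := Finset.exists_max_image
    (Finset.univ.filter fun r => IsParent T r p q) (fun r => T.dist q r)
    ⟨p, by simpa using isParent_self h⟩
  simp only [Finset.mem_filter, Finset.mem_univ, true_and] at hr hmax
  refine ⟨r, ?_, hr⟩
  have hrq : r ≠ q := by
    rintro rfl
    have := hr.2
    simp at this
  obtain ⟨m, hm, -⟩ := existsUnique_parent T hT q r hrq
  rw [SimpleGraph.degree_eq_one_iff_existsUnique_adj]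
  refine ⟨m, hm.1.symm, fun s hs => ?_⟩
  rcases isParent_or_isParent hT q hs with h1 | h1
  · exfalso
    have e1 := h1.2
    have e2 := hr.2
    have t1 := hT.connected.dist_triangle (u := s) (v := p) (w := q)
    have t2 := hT.connected.dist_triangle (u := s) (v := r) (w := p)
    have a1 := SimpleGraph.dist_eq_one_iff_adj.2 h
    have a2 := SimpleGraph.dist_eq_one_iff_adj.2 hs.symm
    have c1 := T.dist_comm (u := q) (v := r)
    have c2 := T.dist_comm (u := q) (v := s)
    have := hmax s ⟨h, by omega⟩
    omega
  · exact h1.eq_left hT hm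

end Combinatorics

/-! ### The energy as a linear form in the transformed coordinates -/

section Energy

variable {V : Type*} [Fintype V] {T : SimpleGraph V} {C : Matrix V V ℝ}

theorem mem_subtrees {U : Finset V} : U ∈ subtrees T ↔ (T.induce (U : Set V)).IsTree := by
  simp [subtrees]

theorem mem_subtrees_iff_connected (hT : T.IsTree) {U : Finset V} :
    U ∈ subtrees T ↔ (T.induce (U : Set V)).Connected := by
  rw [mem_subtrees]
  exact ⟨fun h => h.connected, fun h => ⟨h, hT.isAcyclic.induce _⟩⟩

theorem connected_induce_singleton (l : V) : (T.induce ({l} : Set V)).Connected :=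
  (SimpleGraph.connected_iff _).2 ⟨SimpleGraph.Preconnected.of_subsingleton, ⟨l, rfl⟩⟩

theorem singleton_mem_subtrees (hT : T.IsTree) (l : V) : {l} ∈ subtrees T := by
  rw [mem_subtrees_iff_connected hT, Finset.coe_singleton]
  exact connected_induce_singleton l

-- `l` is a leaf of the graph induced on `insert l U`; deleting or attaching a leaf preserves
-- connectedness, and acyclicity is inherited from `T`.
open Classical in
theorem insert_mem_subtrees_iff (hT : T.IsTree) {U : Finset V} {l p : V} (hl : l ∉ U)
    (hp : p ∈ U) (hpl : T.Adj p l) (huniq : ∀ j ∈ U, T.Adj j l → j = p) :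
    insert l U ∈ subtrees T ↔ U ∈ subtrees T := by
  rw [mem_subtrees_iff_connected hT, mem_subtrees_iff_connected hT]
  constructor
  · intro h
    rw [SimpleGraph.connected_iff]
    refine ⟨?_, ⟨p, hp⟩⟩
    have h1 := h.preconnected.induce_of_degree_eq_one (s := {x | (x : V) ≠ l}) (by
      rintro ⟨v, hv⟩ hvl ⟨a, ha⟩ haa ⟨b, hb⟩ hbb
      simp only [Set.mem_ofPred_eq, not_not] at hvl
      subst hvl
      simp only [SimpleGraph.mem_neighborSet, SimpleGraph.comap_adj,
        Function.Embedding.subtype_apply] at haa hbb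
      have ha' : a ∈ U := by
        rcases Finset.mem_insert.1 (Finset.mem_coe.1 ha) with rfl | h
        · exact absurd rfl haa.ne
        · exact h
      have hb' : b ∈ U := by
        rcases Finset.mem_insert.1 (Finset.mem_coe.1 hb) with rfl | h
        · exact absurd rfl hbb.ne
        · exact h
      exact Subtype.ext ((huniq a ha' haa.symm).trans (huniq b hb' hbb.symm).symm))
    let f : (((T.induce (↑(insert l U) : Set V)).induce {x : ↑(↑(insert l U) : Set V) | (x : V) ≠ l})) →g
        T.induce (U : Set V) :=
      { toFun := fun x => ⟨x.1.1, by
          rcases Finset.mem_insert.1 (Finset.mem_coe.1 x.1.2) with h | h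
          · exact absurd h x.2
          · exact h⟩
        map_rel' := fun {a b} hab => hab }
    refine h1.map f ?_
    rintro ⟨v, hv⟩
    refine ⟨⟨⟨v, by simp [Finset.mem_coe.1 hv]⟩, ?_⟩, rfl⟩
    intro hvl
    have hvl : v = l := hvl
    exact hl (hvl ▸ hv)
  · intro h
    rw [Finset.coe_insert, Set.insert_eq, Set.union_comm]
    exact SimpleGraph.connected_induce_union h.preconnected
      (connected_induce_singleton l).preconnected hp rfl hpl

theorem exists_adj_of_mem_subtrees {U : Finset V} (hU : U ∈ subtrees T) {l : V} (hl : l ∈ U)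
    (hne : U ≠ {l}) : ∃ j ∈ U, T.Adj l j := by
  have h := (mem_subtrees.1 hU).connected.preconnected
  have : Nontrivial (U : Set V) := by
    obtain ⟨m, hm, hml⟩ : ∃ m ∈ U, m ≠ l := by
      by_contra! hc
      exact hne (Finset.eq_singleton_iff_unique_mem.2 ⟨hl, hc⟩)
    exact ⟨⟨⟨m, hm⟩, ⟨l, hl⟩, fun h => hml (congrArg Subtype.val h)⟩⟩
  obtain ⟨⟨j, hj⟩, hadj⟩ := h.exists_adj_of_nontrivial ⟨l, hl⟩
  exact ⟨j, hj, hadj⟩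

/-- The summand of `energy` attached to the subtree with vertex set `U`. -/
def subtreeWeight (T : SimpleGraph V) (C : Matrix V V ℝ) (hC : C.IsSymm) (x : V → ℝ)
    (U : Finset V) : ℝ :=
  (∏ i ∈ U, x i / C i i ^ ((degIn T U i : ℤ) - 1)) * ∏ e ∈ edgesIn T U, edgeWeight C hC e

theorem energy_eq_sum_subtreeWeight (hC : C.IsSymm) (x : V → ℝ) :
    energy T C hC x = ∑ U ∈ subtrees T, subtreeWeight T C hC x U := rfl

theorem subtreeWeight_congr (hC : C.IsSymm) {x x' : V → ℝ} {U : Finset V}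
    (h : ∀ i ∈ U, x i = x' i) : subtreeWeight T C hC x U = subtreeWeight T C hC x' U := by
  rw [subtreeWeight, subtreeWeight, Finset.prod_congr rfl fun i hi => by rw [h i hi]]

theorem subtreeWeight_mul (hC : C.IsSymm) {x x' : V → ℝ} {U : Finset V} {p : V} {t : ℝ}
    (hp : p ∈ U) (hxp : x' p = x p * t) (h : ∀ i ∈ U, i ≠ p → x' i = x i) :
    subtreeWeight T C hC x' U = subtreeWeight T C hC x U * t := by
  classical
  rw [subtreeWeight, subtreeWeight, ← Finset.mul_prod_erase U _ hp,
    ← Finset.mul_prod_erase U (fun i => x i / _) hp, hxp,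
    Finset.prod_congr rfl fun i hi => by
      rw [h i (Finset.mem_of_mem_erase hi) (Finset.ne_of_mem_erase hi)]]
  ring

theorem subtreeWeight_singleton (hC : C.IsSymm) (x : V → ℝ) (l : V) :
    subtreeWeight T C hC x {l} = C l l * x l := by
  classical
  have h1 : degIn T {l} l = 0 := by simp [degIn, Finset.filter_singleton]
  have h2 : edgesIn T {l} = ∅ := by
    rw [edgesIn, Finset.filter_eq_empty_iff]
    intro e
    induction e with
    | _ a b =>
      intro he h
      rw [SimpleGraph.mem_edgeFinset, SimpleGraph.mem_edgeSet] at he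
      have h3 := h a (by simp)
      have h4 := h b (by simp)
      rw [Finset.mem_singleton] at h3 h4
      exact he.ne (h3.trans h4.symm)
  rw [subtreeWeight, h2, Finset.prod_singleton, h1, Finset.prod_empty]
  simp [mul_comm]

-- The new vertex has degree one, hence exponent zero. The degree of `p` rises by one, which costs a
-- factor `C p p`, and the single new edge contributes `C p l`.
open Classical in
theorem subtreeWeight_insert (hC : IsParam T C) (x : V → ℝ) {U : Finset V} {l p : V}
    (hl : l ∉ U) (hp : p ∈ U) (hpl : T.Adj p l) (huniq : ∀ j ∈ U, T.Adj j l → j = p) :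
    subtreeWeight T C hC.symm x (insert l U) =
      subtreeWeight T C hC.symm x U * (C p l / C p p * x l) := by
  have d1 : degIn T (insert l U) l = 1 := by
    rw [degIn, Finset.card_eq_one]
    refine ⟨p, ?_⟩
    ext j
    simp only [Finset.mem_filter, Finset.mem_insert, Finset.mem_singleton]
    constructor
    · rintro ⟨rfl | h1, h2⟩
      · exact absurd rfl h2.ne
      · exact huniq j h1 h2.symm
    · rintro rfl
      exact ⟨Or.inr hp, hpl.symm⟩
  have d2 : degIn T (insert l U) p = degIn T U p + 1 := by
    rw [degIn, degIn, Finset.filter_insert, if_pos hpl, Finset.card_insert_of_notMem]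
    simp [hl]
  have d3 : ∀ i ∈ U, i ≠ p → degIn T (insert l U) i = degIn T U i := by
    intro i hi hip
    rw [degIn, degIn, Finset.filter_insert, if_neg]
    exact fun h => hip (huniq i hi h)
  have e1 : edgesIn T (insert l U) = insert s(p, l) (edgesIn T U) := by
    ext e
    induction e with
    | _ a b =>
      simp only [edgesIn, Finset.mem_filter, Finset.mem_insert, SimpleGraph.mem_edgeFinset,
        SimpleGraph.mem_edgeSet, Sym2.mem_iff, forall_eq_or_imp, forall_eq, Sym2.eq_iff]
      constructor
      · rintro ⟨hab, ha | ha, hb | hb⟩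
        · exact absurd (ha.trans hb.symm) hab.ne
        · subst ha
          exact Or.inl (Or.inr ⟨rfl, huniq b hb hab.symm⟩)
        · subst hb
          exact Or.inl (Or.inl ⟨huniq a ha hab, rfl⟩)
        · exact Or.inr ⟨hab, ha, hb⟩
      · rintro ((⟨rfl, rfl⟩ | ⟨rfl, rfl⟩) | ⟨hab, ha, hb⟩)
        · exact ⟨hpl, Or.inr hp, Or.inl rfl⟩
        · exact ⟨hpl.symm, Or.inl rfl, Or.inr hp⟩
        · exact ⟨hab, Or.inr ha, Or.inr hb⟩
  have e2 : s(p, l) ∉ edgesIn T U := by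
    simp [edgesIn, hl]
  have ew : edgeWeight C hC.symm s(p, l) = C p l := rfl
  rw [subtreeWeight, subtreeWeight, e1, Finset.prod_insert e2, ew, Finset.prod_insert hl, d1,
    ← Finset.mul_prod_erase U _ hp, ← Finset.mul_prod_erase U (fun i => x i / _) hp, d2,
    Finset.prod_congr rfl fun i hi => by
      rw [d3 i (Finset.mem_of_mem_erase hi) (Finset.ne_of_mem_erase hi)]]
  have hc := (hC.diag_pos p).ne'
  have e3 : C p p ^ (((degIn T U p + 1 : ℕ) : ℤ) - 1) =
      C p p ^ ((degIn T U p : ℤ) - 1) * C p p := by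
    rw [← zpow_add_one₀ hc]
    congr 1
    push_cast
    ring
  rw [e3]
  have := zpow_ne_zero ((degIn T U p : ℤ) - 1) hc
  simp only [Nat.cast_one, sub_self, zpow_zero]
  field_simp

open Classical in
/-- The coordinates obtained from `s` by absorbing into each vertex its children lying in `K`. -/
def absorb (T : SimpleGraph V) (C : Matrix V V ℝ) (r : V) (s : V → ℝ) (K : Finset V) (j : V) : ℝ :=
  s j * ∏ i ∈ (children T r j).filter (· ∈ K), (1 + C j i / C j j * Phi T C r s i)

-- Vertices are summed out starting far from the root; `K` is the set already treated. When `l`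
-- joins `K`, the subtrees lost are `{l}`, of weight `C l l * Phi l`, and the sets `insert l U` with
-- the parent `p` of `l` in `U`, of weight `C p l / C p p * Phi l` times that of `U`. Added to the
-- weight of `U`, the latter produce exactly the factor that `absorb` attaches to the coordinate at
-- `p`.
open Classical in
theorem energy_eq_absorb (hT : T.IsTree) (hC : IsParam T C) (r : V) (s : V → ℝ) (n : ℕ) :
    ∀ K : Finset V, K.card = n → (∀ i ∈ K, ∀ j ∈ children T r i, j ∈ K) →
    energy T C hC.symm s = ∑ i ∈ K, C i i * Phi T C r s i +
      ∑ U ∈ (subtrees T).filter (Disjoint · K),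
        subtreeWeight T C hC.symm (absorb T C r s K) U := by
  induction n with
  | zero =>
    intro K hK _
    rw [Finset.card_eq_zero] at hK
    subst hK
    have : absorb T C r s ∅ = s := by
      ext j
      simp [absorb]
    simp [this, energy_eq_sum_subtreeWeight]
  | succ n ih =>
    intro K hKn hK
    -- Taking `l` nearest to the root ensures that no vertex of `K'` has `l` as a child, so `K'` is
    -- still closed under children.
    obtain ⟨l, hl, hmin⟩ := Finset.exists_min_image K (T.dist r)
      (Finset.card_pos.1 (by omega))
    set K' := K.erase l with hK'
    have hchl : ∀ j ∈ children T r l, j ∈ K' := fun j hj =>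
      Finset.mem_erase.2 ⟨(mem_children.1 hj).ne.symm, hK l hl j hj⟩
    have hK'c : ∀ i ∈ K', ∀ j ∈ children T r i, j ∈ K' := by
      intro i hi j hj
      have hi' := Finset.mem_of_mem_erase hi
      refine Finset.mem_erase.2 ⟨?_, hK i hi' j hj⟩
      rintro rfl
      have := (mem_children.1 hj).2
      have := hmin i hi'
      omega
    rw [ih K' (by rw [hK', Finset.card_erase_of_mem hl]; omega) hK'c,
      ← Finset.add_sum_erase K _ hl, ← hK']
    have hal : absorb T C r s K' l = Phi T C r s l := by
      rw [absorb, Phi_eq, Finset.filter_true_of_mem hchl]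
    have hnp : ∀ j, ¬ IsParent T r j l → absorb T C r s K j = absorb T C r s K' j := by
      intro j hj
      rw [absorb, absorb]
      congr 2
      refine Finset.filter_congr fun i hi => ?_
      rw [hK', Finset.mem_erase]
      refine ⟨fun h => ⟨?_, h⟩, fun h => h.2⟩
      rintro rfl
      exact hj (mem_children.1 hi)
    have hpp : ∀ p, IsParent T r p l →
        absorb T C r s K p = absorb T C r s K' p * (1 + C p l / C p p * Phi T C r s l) := by
      intro p hp
      have : (children T r p).filter (· ∈ K) = insert l ((children T r p).filter (· ∈ K')) := by
        ext i
        simp only [Finset.mem_filter, Finset.mem_insert, hK', Finset.mem_erase]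
        constructor
        · rintro ⟨h1, h2⟩
          by_cases h : i = l
          · exact Or.inl h
          · exact Or.inr ⟨h1, h, h2⟩
        · rintro (rfl | ⟨h1, h2, h3⟩)
          · exact ⟨mem_children.2 hp, hl⟩
          · exact ⟨h1, h3⟩
      rw [absorb, absorb, this, Finset.prod_insert (by simp [hK'])]
      ring
    set S := (subtrees T).filter (Disjoint · K) with hS
    let Q : Finset V → Prop := fun U => ∃ p ∈ U, IsParent T r p l
    have hlS : ∀ U ∈ S, l ∉ U := fun U hU hlU =>
      Finset.disjoint_left.1 (Finset.mem_filter.1 hU).2 hlU hl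
    have huniq : ∀ U ∈ S, ∀ p ∈ U, IsParent T r p l → ∀ j ∈ U, T.Adj j l → j = p := by
      intro U hU p _ hpar j hj hjl
      rcases isParent_or_isParent hT r hjl with h1 | h1
      · exact h1.eq_left hT hpar
      · exact absurd (hK l hl j (mem_children.2 h1))
          (Finset.disjoint_left.1 (Finset.mem_filter.1 hU).2 hj)
    have hsplit : (subtrees T).filter (Disjoint · K') =
        S ∪ insert {l} ((S.filter Q).image (insert l)) := by
      ext U
      simp only [Finset.mem_union, Finset.mem_insert, Finset.mem_image]
      constructor
      · intro hU
        obtain ⟨hU1, hU2⟩ := Finset.mem_filter.1 hU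
        by_cases hlU : l ∈ U
        · right
          by_cases hUl : U = {l}
          · exact Or.inl hUl
          · right
            obtain ⟨j, hj, hadj⟩ := exists_adj_of_mem_subtrees hU1 hlU hUl
            have hpar : IsParent T r j l := by
              rcases isParent_or_isParent hT r hadj with h1 | h1
              · exact absurd (hchl j (mem_children.2 h1)) (Finset.disjoint_left.1 hU2 hj)
              · exact h1
            have hjU : j ∈ U.erase l := Finset.mem_erase.2 ⟨hadj.ne.symm, hj⟩
            have hdis : Disjoint (U.erase l) K := by
              rw [Finset.disjoint_left]
              intro i hi hiK
              rw [Finset.mem_erase] at hi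
              exact Finset.disjoint_left.1 hU2 hi.2 (Finset.mem_erase.2 ⟨hi.1, hiK⟩)
            refine ⟨U.erase l, Finset.mem_filter.2 ⟨Finset.mem_filter.2 ⟨?_, hdis⟩, j, hjU, hpar⟩,
              Finset.insert_erase hlU⟩
            rw [← insert_mem_subtrees_iff hT (Finset.notMem_erase l U) hjU hadj.symm,
              Finset.insert_erase hlU]
            · exact hU1
            · intro i hi hil
              rcases isParent_or_isParent hT r hil with h1 | h1
              · exact h1.eq_left hT hpar
              · exact absurd (hK l hl i (mem_children.2 h1)) (Finset.disjoint_left.1 hdis hi)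
        · left
          refine Finset.mem_filter.2 ⟨hU1, ?_⟩
          rw [Finset.disjoint_left] at hU2 ⊢
          intro i hi hiK
          refine hU2 hi (Finset.mem_erase.2 ⟨?_, hiK⟩)
          rintro rfl
          exact hlU hi
      · rintro (hU | rfl | ⟨U', hU', rfl⟩)
        · obtain ⟨hU1, hU2⟩ := Finset.mem_filter.1 hU
          exact Finset.mem_filter.2 ⟨hU1, hU2.mono_right (Finset.erase_subset _ _)⟩
        · exact Finset.mem_filter.2 ⟨singleton_mem_subtrees hT l, by simp [hK']⟩
        · obtain ⟨hU1, p, hpU, hpar⟩ := Finset.mem_filter.1 hU'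
          obtain ⟨hU2, hU3⟩ := Finset.mem_filter.1 hU1
          refine Finset.mem_filter.2 ⟨?_, ?_⟩
          · rw [insert_mem_subtrees_iff hT (hlS _ hU1) hpU hpar.1 (huniq _ hU1 p hpU hpar)]
            exact hU2
          · rw [Finset.disjoint_insert_left]
            exact ⟨Finset.notMem_erase _ _, hU3.mono_right (Finset.erase_subset _ _)⟩
    have hdisj : Disjoint S (insert {l} ((S.filter Q).image (insert l))) := by
      rw [Finset.disjoint_left]
      intro U hU hU'
      refine hlS U hU ?_
      rw [Finset.mem_insert, Finset.mem_image] at hU'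
      rcases hU' with rfl | ⟨U', _, rfl⟩ <;> simp
    have hnot : {l} ∉ (S.filter Q).image (insert l) := by
      rw [Finset.mem_image]
      rintro ⟨U', hU', he⟩
      obtain ⟨hU1, p, hpU, hpar⟩ := Finset.mem_filter.1 hU'
      have : p ∈ ({l} : Finset V) := by rw [← he]; simp [hpU]
      exact hpar.ne (Finset.mem_singleton.1 this)
    have hinj : Set.InjOn (insert l) ((S.filter Q : Finset (Finset V)) : Set (Finset V)) := by
      intro U hU U' hU' he
      rw [← Finset.erase_insert (hlS U (Finset.mem_filter.1 hU).1),
        ← Finset.erase_insert (hlS U' (Finset.mem_filter.1 hU').1), he]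
    rw [hsplit, Finset.sum_union hdisj, Finset.sum_insert hnot, Finset.sum_image hinj,
      subtreeWeight_singleton, hal]
    have hmain : ∑ U ∈ S, subtreeWeight T C hC.symm (absorb T C r s K) U =
        ∑ U ∈ S, (subtreeWeight T C hC.symm (absorb T C r s K') U +
          if Q U then subtreeWeight T C hC.symm (absorb T C r s K') (insert l U) else 0) := by
      refine Finset.sum_congr rfl fun U hU => ?_
      split_ifs with hQ
      · obtain ⟨p, hpU, hpar⟩ := hQ
        rw [subtreeWeight_insert hC _ (hlS U hU) hpU hpar.1 (huniq U hU p hpU hpar), hal,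
          subtreeWeight_mul hC.symm hpU (hpp p hpar)
            (fun i _ hip => hnp i fun h => hip (h.eq_left hT hpar))]
        ring
      · rw [add_zero]
        exact subtreeWeight_congr _ fun i hi => hnp i fun h => hQ ⟨i, hi, h⟩
    rw [hmain, Finset.sum_add_distrib, ← Finset.sum_filter Q]
    ring

/-- The energy is linear in the transformed coordinates, whatever the root. -/
theorem energy_eq_sum_Phi (hT : T.IsTree) (hC : IsParam T C) (r : V) (s : V → ℝ) :
    energy T C hC.symm s = ∑ i, C i i * Phi T C r s i := by
  classical
  rw [energy_eq_absorb hT hC r s _ Finset.univ rfl (by simp),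
    Finset.sum_eq_zero (s := Finset.filter _ _), add_zero]
  intro U hU
  exfalso
  obtain ⟨hU1, hU2⟩ := Finset.mem_filter.1 hU
  obtain ⟨x⟩ := (mem_subtrees.1 hU1).connected.nonempty
  exact Finset.disjoint_left.1 hU2 x.2 (Finset.mem_univ _)

end Energy

/-! ### Jacobian and image density -/

section ChangeOfVariables

variable {V : Type*} [Fintype V] {T : SimpleGraph V} {C : Matrix V V ℝ}

/-- The determinant of a matrix which is triangular with respect to a rank function. -/
theorem det_eq_prod_diag_of_rank [DecidableEq V] (M : Matrix V V ℝ) (d : V → ℕ)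
    (h : ∀ i j, i ≠ j → ¬ d i < d j → M i j = 0) : M.det = ∏ i, M i i := by
  rw [Matrix.det_apply, Finset.sum_eq_single 1]
  · simp
  · intro σ _ hσ
    suffices ∃ i, M (σ i) i = 0 by
      obtain ⟨i, hi⟩ := this
      have hp : ∏ i, M (σ i) i = 0 := Finset.prod_eq_zero (Finset.mem_univ i) hi
      rw [hp, smul_zero]
    -- A nonvanishing term needs `d (σ i) < d i` at every moved `i`, whereas a permutation preserves
    -- `∑ i, d i`.
    by_contra! hc
    have hlt : ∀ i, σ i ≠ i → d (σ i) < d i := fun i hi => by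
      by_contra hn
      exact hc i (h _ _ hi hn)
    obtain ⟨i, hi⟩ : ∃ i, σ i ≠ i := by
      by_contra! h'
      exact hσ (Equiv.ext h')
    have : ∑ i, d (σ i) < ∑ i, d i := by
      refine Finset.sum_lt_sum (fun j _ => ?_) ⟨i, Finset.mem_univ _, hlt i hi⟩
      by_cases hj : σ j = j
      · rw [hj]
      · exact (hlt j hj).le
    rw [Equiv.sum_comp σ d] at this
    exact lt_irrefl _ this
  · intro h
    exact absurd (Finset.mem_univ _) h

theorem contDiffOn_Psi (hC : IsParam T C) (r : V) :
    ContDiffOn ℝ 1 (Psi T C r) (orthant V) := by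
  rw [contDiffOn_pi]
  intro i
  refine ContDiffOn.div ?_ ?_ fun y hy => (prod_children_pos hC hy).ne'
  · exact (contDiff_apply ℝ ℝ i).contDiffOn
  · refine contDiffOn_prod fun j _ => ?_
    exact contDiffOn_const.add (contDiffOn_const.mul (contDiff_apply ℝ ℝ j).contDiffOn)

theorem differentiableAt_Psi (hC : IsParam T C) (r : V) {y : V → ℝ} (hy : y ∈ orthant V) :
    DifferentiableAt ℝ (Psi T C r) y :=
  ((contDiffOn_Psi hC r).differentiableOn one_ne_zero).differentiableAt
    (isOpen_orthant.mem_nhds hy)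

open Classical in
theorem hasDerivAt_Psi_update (hC : IsParam T C) (r : V) {y : V → ℝ} (hy : y ∈ orthant V)
    (i j : V) : HasDerivAt (fun t => Psi T C r (Function.update y j t) i)
      (fderiv ℝ (Psi T C r) y (Pi.single j 1) i) (y j) := by
  have h1 : HasFDerivAt (Psi T C r) (fderiv ℝ (Psi T C r) y) (Function.update y j (y j)) := by
    rw [Function.update_eq_self]
    exact (differentiableAt_Psi hC r hy).hasFDerivAt
  have h2 := h1.comp_hasDerivAt (y j) (hasDerivAt_update y j (y j))
  exact hasDerivAt_pi.1 h2 i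

/-- The coordinate `i` of `Psi` involves only `y i`, linearly, and the children of `i`. The Jacobian
is therefore triangular for the distance to the root, with diagonal entries `Psi T C r y i / y i`.
-/
theorem det_fderiv_Psi (hC : IsParam T C) (r : V) {y : V → ℝ} (hy : y ∈ orthant V) :
    (fderiv ℝ (Psi T C r) y).det = ∏ i, Psi T C r y i / y i := by
  classical
  rw [ContinuousLinearMap.det, ← LinearMap.det_toMatrix',
    det_eq_prod_diag_of_rank _ (T.dist r)]
  · refine Finset.prod_congr rfl fun i _ => ?_
    rw [LinearMap.toMatrix'_apply]
    have h1 := hasDerivAt_Psi_update hC r hy i i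
    have h2 : HasDerivAt (fun t => Psi T C r (Function.update y i t) i) (Psi T C r y i / y i)
        (y i) := by
      have h3 : HasDerivAt (fun t : ℝ => t / ∏ j ∈ children T r i, (1 + C i j / C i i * y j))
          (1 / ∏ j ∈ children T r i, (1 + C i j / C i i * y j)) (y i) :=
        (hasDerivAt_id (y i)).div_const _
      have e : Psi T C r y i / y i = 1 / ∏ j ∈ children T r i, (1 + C i j / C i i * y j) := by
        rw [Psi]
        have := (hy i).ne'
        field_simp
      rw [e]
      refine h3.congr_of_eventuallyEq (Filter.Eventually.of_forall fun t => ?_)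
      simp only [Psi, Function.update_self]
      congr 1
      refine Finset.prod_congr rfl fun j hj => ?_
      rw [Function.update_of_ne (mem_children.1 hj).ne.symm]
    have := h1.unique h2
    rw [← this]
    rfl
  · intro i j hij hd
    rw [LinearMap.toMatrix'_apply]
    have h1 := hasDerivAt_Psi_update hC r hy i j
    have h2 : HasDerivAt (fun t => Psi T C r (Function.update y j t) i) 0 (y j) := by
      refine (hasDerivAt_const (y j) (Psi T C r y i)).congr_of_eventuallyEq
        (Filter.Eventually.of_forall fun t => ?_)
      simp only [Psi, Function.update_of_ne hij]
      congr 1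
      refine Finset.prod_congr rfl fun l hl => ?_
      rw [Function.update_of_ne]
      rintro rfl
      have := (mem_children.1 hl).2
      omega
    have := h1.unique h2
    rw [← this]
    rfl

theorem image_Psi_orthant (hC : IsParam T C) (r : V) : Psi T C r '' orthant V = orthant V := by
  ext x
  constructor
  · rintro ⟨y, hy, rfl⟩
    exact Psi_mem_orthant hC r hy
  · exact fun hx => ⟨_, Phi_mem_orthant hC r hx, Psi_Phi hC r hx⟩

/-- Change of variables: the image under `Phi` of a law with a density on the orthant. -/
theorem map_Phi_withDensity (hC : IsParam T C) (r : V) (f : (V → ℝ) → ℝ) :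
    Measure.map (Phi T C r) ((volume.restrict (orthant V)).withDensity
      fun x => ENNReal.ofReal (f x)) = (volume.restrict (orthant V)).withDensity
      fun y => ENNReal.ofReal (f (Psi T C r y) * ∏ i, Psi T C r y i / y i) := by
  classical
  have hm : Measurable (Phi T C r) := (continuous_Phi r).measurable
  refine Measure.ext fun s hs => ?_
  rw [Measure.map_apply hm hs, withDensity_apply _ (hm hs), withDensity_apply _ hs,
    ← lintegral_indicator (hm hs), ← lintegral_indicator hs]
  conv_lhs => rw [← image_Psi_orthant hC r]
  rw [lintegral_image_eq_lintegral_abs_det_fderiv_mul volume measurableSet_orthant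
    (f := Psi T C r) (f' := fderiv ℝ (Psi T C r))
    (fun y hy => (differentiableAt_Psi hC r hy).hasFDerivAt.hasFDerivWithinAt)
    (fun y hy y' hy' h => by rw [← Phi_Psi hC r hy, h, Phi_Psi hC r hy'])]
  refine setLIntegral_congr_fun measurableSet_orthant fun y hy => ?_
  have hpos : 0 < ∏ i, Psi T C r y i / y i :=
    Finset.prod_pos fun i _ => div_pos (Psi_mem_orthant hC r hy i) (hy i)
  simp only [det_fderiv_Psi hC r hy, abs_of_pos hpos, Set.indicator, Set.mem_preimage,
    Phi_Psi hC r hy]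
  split_ifs
  · rw [← ENNReal.ofReal_mul hpos.le, mul_comm]
  · rw [mul_zero]

end ChangeOfVariables

/-! ### Continuous densities of product laws -/

section Separability

variable {V : Type*} [Fintype V]

open Classical in
/-- Exchange of the coordinate `q` between two vectors. -/
def exchange (q : V) : ((V → ℝ) × (V → ℝ)) ≃ᵐ ((V → ℝ) × (V → ℝ)) where
  toFun z := (Function.update z.1 q (z.2 q), Function.update z.2 q (z.1 q))
  invFun z := (Function.update z.1 q (z.2 q), Function.update z.2 q (z.1 q))
  left_inv z := by simp
  right_inv z := by simp
  measurable_toFun := by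
    refine Measurable.prodMk ?_ ?_ <;> refine measurable_pi_iff.2 fun i => ?_ <;>
    · by_cases h : i = q
      · subst h
        simp only [Function.update_self]
        fun_prop
      · simp only [Function.update_of_ne h]
        fun_prop
  measurable_invFun := by
    refine Measurable.prodMk ?_ ?_ <;> refine measurable_pi_iff.2 fun i => ?_ <;>
    · by_cases h : i = q
      · subst h
        simp only [Function.update_self]
        fun_prop
      · simp only [Function.update_of_ne h]
        fun_prop

open Classical in
theorem exchange_apply (q : V) (z : (V → ℝ) × (V → ℝ)) :
    exchange q z = (Function.update z.1 q (z.2 q), Function.update z.2 q (z.1 q)) := rfl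

theorem exchange_exchange (q : V) (z : (V → ℝ) × (V → ℝ)) : exchange q (exchange q z) = z :=
  (exchange q).left_inv z

/-- Squares of product measures are invariant under the exchange of a coordinate. -/
theorem measurePreserving_exchange (ν : V → Measure ℝ) [∀ i, SigmaFinite (ν i)] (q : V) :
    MeasurePreserving (exchange q) ((Measure.pi ν).prod (Measure.pi ν))
      ((Measure.pi ν).prod (Measure.pi ν)) := by
  classical
  -- Regrouped as a vector of pairs, a pair of vectors undergoes the swap of the single pair at `q`.
  have h1 := measurePreserving_arrowProdEquivProdArrow ℝ ℝ V ν ν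
  have h2 := measurePreserving_pi (fun i => (ν i).prod (ν i)) (fun i => (ν i).prod (ν i))
    (f := fun i => if i = q then Prod.swap else id) (fun i => by
      by_cases h : i = q
      · simp only [h, if_true]
        exact Measure.measurePreserving_swap
      · simp only [h, if_false]
        exact MeasurePreserving.id _)
  have h3 := (h1.comp h2).comp (h1.symm _)
  convert h3 using 1
  funext z
  refine Prod.ext (funext fun i => ?_) (funext fun i => ?_) <;>
  · by_cases h : i = q
    · subst h
      simp [exchange_apply, MeasurableEquiv.arrowProdEquivProdArrow,
        Equiv.arrowProdEquivProdArrow]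
    · simp [exchange_apply, MeasurableEquiv.arrowProdEquivProdArrow,
        Equiv.arrowProdEquivProdArrow, h]

theorem restrict_orthant_eq_pi : (volume.restrict (orthant V) : Measure (V → ℝ)) =
    Measure.pi fun _ => (volume : Measure ℝ).restrict (Set.Ioi 0) := by
  rw [orthant_eq_pi, volume_pi, Measure.restrict_pi_pi]

theorem exchange_mem_orthant (q : V) {z : (V → ℝ) × (V → ℝ)} (hz : z ∈ orthant V ×ˢ orthant V) :
    exchange q z ∈ orthant V ×ˢ orthant V := by
  classical
  refine ⟨fun i => ?_, fun i => ?_⟩ <;>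
  · by_cases h : i = q
    · subst h
      simp [exchange_apply, hz.1 i, hz.2 i]
    · simp [exchange_apply, h, hz.1 i, hz.2 i]

theorem continuous_exchange (q : V) : Continuous (exchange q) := by
  classical
  change Continuous fun z : (V → ℝ) × (V → ℝ) =>
    (Function.update z.1 q (z.2 q), Function.update z.2 q (z.1 q))
  fun_prop

open Classical in
/-- A continuous density of a product law on the orthant is multiplicatively separable. -/
theorem density_exchange {h : (V → ℝ) → ℝ} (hpos : ∀ y ∈ orthant V, 0 < h y)
    (hcont : ContinuousOn h (orthant V)) (ν : V → Measure ℝ) [∀ i, SigmaFinite (ν i)]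
    (hlaw : (volume.restrict (orthant V)).withDensity (fun y => ENNReal.ofReal (h y)) =
      Measure.pi ν) (q : V) {y y' : V → ℝ} (hy : y ∈ orthant V) (hy' : y' ∈ orthant V) :
    h y * h y' = h (Function.update y q (y' q)) * h (Function.update y' q (y q)) := by
  set l : Measure (V → ℝ) := volume.restrict (orthant V) with hl
  have hmeas : AEMeasurable (fun y => ENNReal.ofReal (h y)) l :=
    (hcont.aemeasurable measurableSet_orthant).ennreal_ofReal
  -- `ρ` is the joint density of two independent copies. Invariance of their law under the exchange
  -- makes `ρ` invariant almost everywhere, and continuity removes the null set; no marginal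
  -- densities are needed.
  set ρ : (V → ℝ) × (V → ℝ) → ENNReal :=
    fun z => ENNReal.ofReal (h z.1) * ENNReal.ofReal (h z.2) with hρ
  have hσl : MeasurePreserving (exchange q) (l.prod l) (l.prod l) := by
    rw [hl, restrict_orthant_eq_pi]
    exact measurePreserving_exchange _ q
  have hρm : AEMeasurable ρ (l.prod l) :=
    (hmeas.comp_quasiMeasurePreserving Measure.quasiMeasurePreserving_fst).mul
      (hmeas.comp_quasiMeasurePreserving Measure.quasiMeasurePreserving_snd)
  have hprod : (Measure.pi ν).prod (Measure.pi ν) = (l.prod l).withDensity ρ := by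
    rw [← hlaw, prod_withDensity₀ hmeas hmeas]
  have hinv := (measurePreserving_exchange ν q).map_eq
  rw [hprod] at hinv
  have hmap : Measure.map (exchange q) ((l.prod l).withDensity ρ) =
      (l.prod l).withDensity (ρ ∘ exchange q) := by
    refine Measure.ext fun s hs => ?_
    rw [(exchange q).map_apply, withDensity_apply _ ((exchange q).measurable hs),
      withDensity_apply _ hs,
      ← hσl.setLIntegral_comp_preimage_emb (exchange q).measurableEmbedding]
    have hss : exchange q ⁻¹' (exchange q ⁻¹' s) = s := by
      ext z
      simp [exchange_exchange]
    rw [hss]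
    rfl
  rw [hmap] at hinv
  have hae := (withDensity_eq_iff_of_sigmaFinite
    (hρm.comp_quasiMeasurePreserving hσl.quasiMeasurePreserving) hρm).1 hinv
  have hll : l.prod l = (volume : Measure ((V → ℝ) × (V → ℝ))).restrict
      (orthant V ×ˢ orthant V) := by
    rw [hl, Measure.prod_restrict]
    rfl
  set R : (V → ℝ) × (V → ℝ) → ℝ := fun z => h z.1 * h z.2 with hR
  have hRc : ContinuousOn R (orthant V ×ˢ orthant V) :=
    (hcont.comp continuousOn_fst fun z hz => hz.1).mul
      (hcont.comp continuousOn_snd fun z hz => hz.2)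
  have hopen : IsOpen (orthant V ×ˢ orthant V) := isOpen_orthant.prod isOpen_orthant
  have hRR : R =ᵐ[(volume : Measure ((V → ℝ) × (V → ℝ))).restrict (orthant V ×ˢ orthant V)]
      R ∘ exchange q := by
    rw [hll] at hae
    filter_upwards [hae, ae_restrict_mem hopen.measurableSet] with z hz hzo
    have e : ∀ w ∈ orthant V ×ˢ orthant V, ρ w = ENNReal.ofReal (R w) := fun w hw => by
      rw [hρ, hR, ENNReal.ofReal_mul (hpos _ hw.1).le]
    have hzo' := exchange_mem_orthant q hzo
    rw [Function.comp_apply, e _ hzo, e _ hzo', ENNReal.ofReal_eq_ofReal_iff] at hz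
    · exact hz.symm
    · exact (mul_pos (hpos _ hzo'.1) (hpos _ hzo'.2)).le
    · exact (mul_pos (hpos _ hzo.1) (hpos _ hzo.2)).le
  exact Measure.eqOn_open_of_ae_eq hRR hopen hRc
    (hRc.comp (continuous_exchange q).continuousOn fun z hz => exchange_mem_orthant q hz)
    (show (y, y') ∈ orthant V ×ˢ orthant V from ⟨hy, hy'⟩)

end Separability

/-! ### Gradient of the log-density, edge by edge -/

section LogDensity

variable {V : Type*} [Fintype V] {T : SimpleGraph V} {C : Matrix V V ℝ}

open Classical in
/-- Replacing the coordinate `q` of `Phi T C r s` affects only the coordinates of `s` at `q` and at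
the parent of `q`. -/
theorem Psi_update (hT : T.IsTree) (hC : IsParam T C) {r p q : V} (hpq : IsParent T r p q)
    {y : V → ℝ} (hy : y ∈ orthant V) {t : ℝ} (ht : 0 < t) :
    Psi T C r (Function.update y q t) =
      Function.update (Function.update (Psi T C r y) p
        (Psi T C r y p * (1 + C p q / C p p * y q) / (1 + C p q / C p p * t))) q
        (Psi T C r y q * t / y q) := by
  have hk := coeff_pos hC hpq.1
  have hyq := hy q
  ext i
  by_cases hiq : i = q
  · subst hiq
    rw [Function.update_self, Psi, Psi, Function.update_self,
      Finset.prod_congr rfl fun j hj => by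
        rw [Function.update_of_ne (mem_children.1 hj).ne.symm]]
    field_simp
  · rw [Function.update_of_ne hiq]
    by_cases hip : i = p
    · subst hip
      have hq := mem_children.2 hpq
      rw [Function.update_self, Psi, Psi, Function.update_of_ne hiq,
        ← Finset.mul_prod_erase _ _ hq, ← Finset.mul_prod_erase _ (fun j => _ + _ * y j) hq,
        Function.update_self, Finset.prod_congr rfl fun j hj => by
          rw [Function.update_of_ne (Finset.ne_of_mem_erase hj)]]
      have h1 : 0 < 1 + C i q / C i i * y q := by positivity
      have h2 : 0 < 1 + C i q / C i i * t := by positivity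
      generalize 1 + C i q / C i i * y q = α at *
      generalize 1 + C i q / C i i * t = β at *
      field_simp
    · have hne : ∀ j ∈ children T r i, j ≠ q := by
        rintro j hj rfl
        exact hip ((mem_children.1 hj).eq_left hT hpq)
      rw [Function.update_of_ne hip, Psi, Psi, Function.update_of_ne hiq,
        Finset.prod_congr rfl fun j hj => by rw [Function.update_of_ne (hne j hj)]]

/-- The transform at `i` is linear in the coordinate at `i`. -/
theorem Phi_eq_mul {r i : V} {x x' : V → ℝ} (hx : x i ≠ 0)
    (h : ∀ l, T.dist r i < T.dist r l → x' l = x l) :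
    Phi T C r x' i = x' i * (Phi T C r x i / x i) := by
  rw [Phi_eq, Phi_eq T C r x, Finset.prod_congr rfl fun j hj => by
    rw [Phi_congr (s' := x) j fun l hl => h l (by have := (mem_children.1 hj).2; omega)]]
  field_simp

/-- The transform at the root, decomposed along an edge at the root. -/
theorem Phi_root_eq (hT : T.IsTree) {p q : V} (h : T.Adj p q) (x : V → ℝ) :
    Phi T C p x p = Phi T C q x p * (1 + C p q / C p p * Phi T C p x q) := by
  classical
  have hc : children T p p = insert q (children T q p) := by
    ext j
    rw [mem_children_root, Finset.mem_insert, mem_children_of_isParent hT (isParent_self h.symm)]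
    by_cases hj : j = q
    · simp [hj, h]
    · simp [hj]
  have hq : q ∉ children T q p := by
    rw [mem_children_of_isParent hT (isParent_self h.symm)]
    simp
  rw [Phi_eq, Phi_eq T C q x p, hc, Finset.prod_insert hq,
    Finset.prod_congr rfl fun j hj => by
      rw [← Phi_eq_of_isParent (C := C) hT (mem_children.1 hj)]]
  ring

open Classical in
/-- The point with the coordinates of `x` outside `{p, q}` and with prescribed values
`Phi T C q · p = u` and `Phi T C p · q = v`. -/
def edgePoint (T : SimpleGraph V) (C : Matrix V V ℝ) (p q : V) (x : V → ℝ) (u v : ℝ) : V → ℝ :=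
  Function.update (Function.update x p (u / (Phi T C q x p / x p))) q
    (v / (Phi T C p x q / x q))

theorem edgePoint_comm {p q : V} (h : p ≠ q) (x : V → ℝ) (u v : ℝ) :
    edgePoint T C p q x u v = edgePoint T C q p x v u := by
  classical
  rw [edgePoint, edgePoint, Function.update_comm h]

theorem edgePoint_mem_orthant (hC : IsParam T C) (p q : V) {x : V → ℝ} (hx : x ∈ orthant V)
    {u v : ℝ} (hu : 0 < u) (hv : 0 < v) : edgePoint T C p q x u v ∈ orthant V := by
  classical
  intro i
  have h1 := Phi_mem_orthant hC q hx p
  have h2 := Phi_mem_orthant hC p hx q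
  have h3 := hx p
  have h4 := hx q
  by_cases hiq : i = q
  · subst hiq
    rw [edgePoint, Function.update_self]
    positivity
  · by_cases hip : i = p
    · subst hip
      rw [edgePoint, Function.update_of_ne hiq, Function.update_self]
      positivity
    · rw [edgePoint, Function.update_of_ne hiq, Function.update_of_ne hip]
      exact hx i

/-- `Phi T C p · q` ignores the coordinate at `p` and is linear in the one at `q`; `edgePoint`
divides `v` by the slope. -/
theorem Phi_edgePoint_right (hC : IsParam T C) {p q : V} (h : T.Adj p q) {x : V → ℝ}
    (hx : x ∈ orthant V) (u v : ℝ) : Phi T C p (edgePoint T C p q x u v) q = v := by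
  classical
  rw [Phi_eq_mul (x := x) (hx q).ne']
  · rw [edgePoint, Function.update_self]
    exact div_mul_cancel₀ _ (div_pos (Phi_mem_orthant hC p hx q) (hx q)).ne'
  · intro l hl
    rw [edgePoint, Function.update_of_ne, Function.update_of_ne]
    · rintro rfl
      simp at hl
    · rintro rfl
      simp at hl

open Classical in
/-- Additive separability of `L ∘ Psi T C r` with respect to the coordinate `q`. -/
def IsSeparable (T : SimpleGraph V) (C : Matrix V V ℝ) (r q : V) (L : (V → ℝ) → ℝ) : Prop :=
  ∀ y ∈ orthant V, ∀ y' ∈ orthant V, L (Psi T C r y) + L (Psi T C r y') =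
    L (Psi T C r (Function.update y q (y' q))) + L (Psi T C r (Function.update y' q (y q)))

theorem one_mem_orthant : (1 : V → ℝ) ∈ orthant V := fun _ => one_pos

open Classical in
/-- Restricted to the two coordinates of an edge, a separable function splits. -/
theorem IsSeparable.edge_split (hT : T.IsTree) (hC : IsParam T C) {r p q : V}
    (hpq : IsParent T r p q) {L : (V → ℝ) → ℝ} (hL : IsSeparable T C r q L) {x : V → ℝ}
    (hx : x ∈ orthant V) {u v : ℝ} (hu : 0 < u) (hv : 0 < v) :
    L (edgePoint T C p q x u v) =
      L (edgePoint T C p q x (u * (1 + C p q / C p p * v) / (1 + C p q / C p p)) 1) +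
      (L (Psi T C r (Function.update 1 q v)) - L (Psi T C r 1)) := by
  have hX := edgePoint_mem_orthant (T := T) hC p q hx hu hv
  have hPq : Phi T C r (edgePoint T C p q x u v) q = v := by
    rw [Phi_eq_of_isParent hT hpq, Phi_edgePoint_right hC hpq.1 hx]
  have hY := Phi_mem_orthant hC r hX
  -- The reference point `y' = 1` replaces the transformed coordinate `v` at `q` by `1`. This
  -- rescales the coordinate at `p` so that `u * (1 + k * v)`, with `k = C p q / C p p`, keeps its
  -- value.
  have h := hL _ hY 1 one_mem_orthant
  rw [Psi_Phi hC r hX, Pi.one_apply, Psi_update hT hC hpq hY one_pos, Psi_Phi hC r hX, hPq,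
    mul_one] at h
  have e : Function.update (Function.update (edgePoint T C p q x u v) p
      (edgePoint T C p q x u v p * (1 + C p q / C p p * v) / (1 + C p q / C p p))) q
      (edgePoint T C p q x u v q * 1 / v) =
      edgePoint T C p q x (u * (1 + C p q / C p p * v) / (1 + C p q / C p p)) 1 := by
    ext i
    by_cases hiq : i = q
    · subst hiq
      simp only [edgePoint, Function.update_self]
      field_simp
    · by_cases hip : i = p
      · subst hip
        simp only [edgePoint, Function.update_self, Function.update_of_ne hiq]
        ring
      · simp only [edgePoint, Function.update_of_ne hiq, Function.update_of_ne hip]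
  rw [e] at h
  linarith

theorem contDiffOn_comp_curve {L : (V → ℝ) → ℝ} (hL : ContDiffOn ℝ 1 L (orthant V))
    {γ : ℝ → V → ℝ} (hγ : ContDiff ℝ 1 γ) (h : ∀ t, 0 < t → γ t ∈ orthant V) :
    ContDiffOn ℝ 1 (fun t => L (γ t)) (Set.Ioi 0) :=
  hL.comp hγ.contDiffOn h

theorem contDiff_edgePoint_left (p q : V) (x : V → ℝ) (v d : ℝ) :
    ContDiff ℝ 1 fun s : ℝ => edgePoint T C p q x (s / d) v := by
  classical
  rw [contDiff_pi]
  intro i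
  by_cases hiq : i = q
  · subst hiq
    simp only [edgePoint, Function.update_self]
    fun_prop
  · by_cases hip : i = p
    · subst hip
      simp only [edgePoint, Function.update_of_ne hiq, Function.update_self]
      fun_prop
    · simp only [edgePoint, Function.update_of_ne hiq, Function.update_of_ne hip]
      fun_prop

open Classical in
theorem update_one_mem_orthant (q : V) {v : ℝ} (hv : 0 < v) :
    Function.update (1 : V → ℝ) q v ∈ orthant V := by
  intro i
  by_cases h : i = q
  · subst h
    simpa using hv
  · simp [h]

open Classical in
theorem contDiffOn_Psi_update (hC : IsParam T C) {L : (V → ℝ) → ℝ}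
    (hL : ContDiffOn ℝ 1 L (orthant V)) (r q : V) :
    ContDiffOn ℝ 1 (fun v => L (Psi T C r (Function.update 1 q v))) (Set.Ioi 0) :=
  (hL.comp (contDiffOn_Psi hC r) fun _ hy => Psi_mem_orthant hC r hy).comp
    (contDiff_update 1 (1 : V → ℝ) q).contDiffOn fun _ hv => update_one_mem_orthant q hv

open Classical in
theorem edgePoint_update (hC : IsParam T C) {p q : V} (h : p ≠ q) {x : V → ℝ}
    (hx : x ∈ orthant V) (t : ℝ) :
    Function.update x p t =
      edgePoint T C p q x (t * (Phi T C q x p / x p)) (Phi T C p x q) := by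
  have h1 := Phi_mem_orthant hC q hx p
  have h2 := Phi_mem_orthant hC p hx q
  have h3 := hx p
  have h4 := hx q
  ext i
  by_cases hiq : i = q
  · subst hiq
    simp only [edgePoint, Function.update_self, Function.update_of_ne h.symm]
    field_simp
  · by_cases hip : i = p
    · subst hip
      simp only [edgePoint, Function.update_of_ne hiq, Function.update_self]
      field_simp
    · simp only [edgePoint, Function.update_of_ne hiq, Function.update_of_ne hip]

open Classical in
/-- The partial derivative of `L` at `p` obtained from the splitting along an edge. -/
theorem hasDerivAt_of_edge_split (hT : T.IsTree) (hC : IsParam T C) {p q : V} (h : T.Adj p q)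
    {L : (V → ℝ) → ℝ} (hL : ContDiffOn ℝ 1 L (orthant V)) {H : ℝ → ℝ} {x : V → ℝ}
    (hx : x ∈ orthant V) {A c : ℝ}
    (hsplit : ∀ u v, 0 < u → 0 < v → L (edgePoint T C p q x u v) =
      L (edgePoint T C p q x (u * (1 + C p q / C p p * v) / (1 + C p q / C p p)) 1) + H v)
    (hF : ∀ s, 0 < s → deriv (fun s => L (edgePoint T C p q x (s / (1 + C p q / C p p)) 1)) s =
      A / s - c * C p p) :
    HasDerivAt (fun t => L (Function.update x p t)) ((A - c * (C p p * Phi T C p x p)) / x p)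
      (x p) := by
  have h1 := Phi_mem_orthant hC q hx p
  have h2 := Phi_mem_orthant hC p hx q
  have h3 := hx p
  have hk := coeff_pos hC h
  have hs : 0 < Phi T C p x p := Phi_mem_orthant hC p hx p
  have hroot := Phi_root_eq (C := C) hT h x
  -- `m` is the slope of `Phi T C p x p` as a linear function of `x p`. Since `Phi T C p x q`
  -- ignores `x p`, varying `x p` moves only the argument `t * m` of `F` below.
  set m : ℝ := Phi T C q x p / x p * (1 + C p q / C p p * Phi T C p x q) with hm
  have hsm : x p * m = Phi T C p x p := by
    rw [hroot, hm]
    field_simp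
  set F : ℝ → ℝ := fun s => L (edgePoint T C p q x (s / (1 + C p q / C p p)) 1) with hFdef
  have hFd : HasDerivAt F (A / Phi T C p x p - c * C p p) (x p * m) := by
    have hc := contDiffOn_comp_curve hL (contDiff_edgePoint_left (T := T) (C := C) p q x 1
      (1 + C p q / C p p)) fun t ht => edgePoint_mem_orthant hC p q hx (by positivity) one_pos
    have := ((hc.differentiableOn one_ne_zero).differentiableAt
      (Ioi_mem_nhds hs)).hasDerivAt
    rw [hF _ hs] at this
    rw [hsm]
    exact this
  have hcomp := (hFd.comp (x p) ((hasDerivAt_id (x p)).mul_const m)).add_const (H (Phi T C p x q))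
  have hval : (A / Phi T C p x p - c * C p p) * (1 * m) =
      (A - c * (C p p * Phi T C p x p)) / x p := by
    rw [← hsm]
    have : 0 < m := by positivity
    field_simp
  rw [hval] at hcomp
  refine hcomp.congr_of_eventuallyEq ?_
  filter_upwards [Ioi_mem_nhds h3] with t ht
  have ht : 0 < t := ht
  rw [edgePoint_update hC h.ne hx, hsplit _ _ (by positivity) h2]
  simp only [Function.comp_apply, id, hFdef, hm]
  congr 4
  ring

open Classical in
/-- The shape of the partial derivatives of the logarithm of the density. -/
def HasGradientAt (T : SimpleGraph V) (C : Matrix V V ℝ) (L : (V → ℝ) → ℝ) (p : V)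
    (A c : ℝ) : Prop :=
  ∀ x ∈ orthant V, HasDerivAt (fun t => L (Function.update x p t))
    ((A - c * (C p p * Phi T C p x p)) / x p) (x p)

/-- The roots `r` and `r'` lie on opposite sides of the edge, so the two splittings of `L` in the
edge coordinates combine into the functional equation. -/
theorem exists_gradient_of_edge (hT : T.IsTree) (hC : IsParam T C) {L : (V → ℝ) → ℝ}
    (hL : ContDiffOn ℝ 1 L (orthant V)) {r r' p q : V} (hr : IsParent T r p q)
    (hr' : IsParent T r' q p) (hs : IsSeparable T C r q L) (hs' : IsSeparable T C r' p L) :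
    ∃ A B c : ℝ, HasGradientAt T C L p A c ∧ HasGradientAt T C L q B c := by
  classical
  set k := C p q / C p p with hk
  set k' := C q p / C q q with hk'
  have hkp : 0 < k := coeff_pos hC hr.1
  have hkp' : 0 < k' := coeff_pos hC hr'.1
  have hp := hC.diag_pos p
  have hq := hC.diag_pos q
  have hpq := hC.edge_pos p q hr.1
  have hsym : C q p = C p q := hC.symm.apply p q
  set H : ℝ → ℝ := fun v => L (Psi T C r (Function.update 1 q v)) - L (Psi T C r 1) with hH
  set G : ℝ → ℝ := fun u => L (Psi T C r' (Function.update 1 p u)) - L (Psi T C r' 1) with hG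
  have hHd : DifferentiableOn ℝ H (Set.Ioi 0) :=
    ((contDiffOn_Psi_update hC hL r q).differentiableOn one_ne_zero).sub_const _
  have hGd : DifferentiableOn ℝ G (Set.Ioi 0) :=
    ((contDiffOn_Psi_update hC hL r' p).differentiableOn one_ne_zero).sub_const _
  have main : ∀ x ∈ orthant V, ∃ A B c : ℝ,
      (∀ s, 0 < s → deriv (fun s => L (edgePoint T C p q x (s / (1 + k)) 1)) s =
        A / s - c * k') ∧
      (∀ s, 0 < s → deriv (fun s => L (edgePoint T C q p x (s / (1 + k')) 1)) s =
        B / s - c * k) ∧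
      ∀ v, 0 < v → deriv H v = B / v - A * k / (1 + k * v) - c * k := by
    intro x hx
    refine functional_equation hkp hkp'
      (contDiffOn_comp_curve hL (contDiff_edgePoint_left p q x 1 (1 + k)) fun t ht =>
        edgePoint_mem_orthant hC p q hx (by positivity) one_pos) hGd hHd
      (contDiffOn_comp_curve hL (contDiff_edgePoint_left q p x 1 (1 + k')) fun t ht =>
        edgePoint_mem_orthant hC q p hx (by positivity) one_pos) fun u v hu hv => ?_
    have e1 := hs.edge_split hT hC hr hx hu hv
    have e2 := hs'.edge_split hT hC hr' hx hv hu
    rw [edgePoint_comm hr.1.ne] at e1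
    simp only [hH, hG]
    linarith
  -- `H` does not involve `x`, so its derivative identifies the constants found at any `x` with
  -- those at `1`. The factor put on `c` next is symmetric in the edge: it turns `c * k'` into a
  -- multiple of `C p p` and `c * k` into the same multiple of `C q q`.
  obtain ⟨A, B, c, -, -, h0⟩ := main 1 one_mem_orthant
  refine ⟨A, B, c * (C p q / (C p p * C q q)), fun x hx => ?_, fun x hx => ?_⟩
  all_goals
    obtain ⟨A', B', c', h1, h2, h3⟩ := main x hx
    obtain ⟨rfl, rfl, rfl⟩ := coeff_unique hkp fun v hv => (h0 v hv).symm.trans (h3 v hv)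
  · refine hasDerivAt_of_edge_split hT hC hr.1 hL (H := H) hx
      (fun u v hu hv => hs.edge_split hT hC hr hx hu hv) fun s hs => ?_
    rw [h1 s hs, hk', hsym]
    field_simp
  · refine hasDerivAt_of_edge_split hT hC hr'.1 hL (H := G) hx
      (fun u v hu hv => hs'.edge_split hT hC hr' hx hu hv) fun s hs => ?_
    rw [h2 s hs, hk]
    field_simp

/-- Doubling `x p` doubles `Phi T C p x p`, so both coefficients are determined. This glues the
constants of edges sharing a vertex. -/
theorem HasGradientAt.unique (hC : IsParam T C) {L : (V → ℝ) → ℝ} {p : V} {A c A' c' : ℝ}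
    (h : HasGradientAt T C L p A c) (h' : HasGradientAt T C L p A' c') : A = A' ∧ c = c' := by
  classical
  have hp := hC.diag_pos p
  have key : ∀ x ∈ orthant V, A - c * (C p p * Phi T C p x p) =
      A' - c' * (C p p * Phi T C p x p) := fun x hx => by
    have := (h x hx).unique (h' x hx)
    have h3 := hx p
    field_simp at this
    linarith
  have h1 := key 1 one_mem_orthant
  have h2 := key _ (update_one_mem_orthant p two_pos)
  have hs := Phi_mem_orthant hC p (one_mem_orthant (V := V)) p
  rw [Phi_eq_mul (x := 1) one_ne_zero (fun l hl => by
    rw [Function.update_of_ne]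
    rintro rfl
    simp at hl), Function.update_self, Pi.one_apply, div_one] at h2
  have h3 : (c - c') * (C p p * Phi T C p 1 p) = 0 := by linarith
  have h4 : c - c' = 0 := (mul_eq_zero.1 h3).resolve_right (by positivity)
  have h5 : c = c' := by linarith
  subst h5
  exact ⟨by linarith, rfl⟩

/-- The logarithmic density has the gradient of a tree-Kummer density. -/
theorem exists_gradient [DecidableRel T.Adj] (hT : T.IsTree) (hcard : 2 ≤ Fintype.card V)
    (hC : IsParam T C) {L : (V → ℝ) → ℝ} (hL : ContDiffOn ℝ 1 L (orthant V))
    (hs : ∀ r, T.degree r = 1 → ∀ q, IsSeparable T C r q L) :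
    ∃ (a : V → ℝ) (c : ℝ), ∀ p, HasGradientAt T C L p (a p) c := by
  have hedge : ∀ p q, T.Adj p q →
      ∃ A B c : ℝ, HasGradientAt T C L p A c ∧ HasGradientAt T C L q B c := by
    intro p q h
    obtain ⟨r, hr1, hr⟩ := exists_leaf_isParent hT h
    obtain ⟨r', hr1', hr'⟩ := exists_leaf_isParent hT h.symm
    exact exists_gradient_of_edge hT hC hL hr hr' (hs r hr1 q) (hs r' hr1' p)
  have : Nontrivial V := Fintype.one_lt_card_iff_nontrivial.1 hcard
  have hv : ∀ p, ∃ A c : ℝ, HasGradientAt T C L p A c := fun p => by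
    obtain ⟨q, hq⟩ := hT.connected.preconnected.exists_adj_of_nontrivial p
    obtain ⟨A, B, c, h1, -⟩ := hedge p q hq
    exact ⟨A, c, h1⟩
  choose a c hac using hv
  obtain ⟨p₀⟩ := hT.connected.nonempty
  have hc : ∀ p, c p = c p₀ := by
    intro p
    obtain ⟨w⟩ := hT.connected.preconnected p p₀
    induction w with
    | nil => rfl
    | cons hadj _ ih =>
      rw [← ih]
      obtain ⟨A, B, c', h1, h2⟩ := hedge _ _ hadj
      rw [((hac _).unique hC h1).2, ((hac _).unique hC h2).2]
  exact ⟨a, c p₀, fun p => hc p ▸ hac p⟩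

/-- With `p` as the root, only the term `i = p` of `∑ i, C i i * Phi T C p x i` involves `x p`, and
it does so linearly. -/
theorem hasDerivAt_energy (hT : T.IsTree) (hC : IsParam T C) (p : V) {x : V → ℝ}
    (hx : x ∈ orthant V) [DecidableEq V] :
    HasDerivAt (fun t => energy T C hC.symm (Function.update x p t))
      (C p p * Phi T C p x p / x p) (x p) := by
  have h1 : (fun t => energy T C hC.symm (Function.update x p t)) = fun t =>
      C p p * (t * (Phi T C p x p / x p)) +
        ∑ i ∈ Finset.univ.erase p, C i i * Phi T C p x i := by
    funext t
    rw [energy_eq_sum_Phi hT hC p, ← Finset.add_sum_erase _ _ (Finset.mem_univ p),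
      Phi_eq_mul (x := x) (hx p).ne' (fun l hl => by
        rw [Function.update_of_ne]
        rintro rfl
        simp at hl), Function.update_self]
    congr 1
    refine Finset.sum_congr rfl fun i hi => ?_
    rw [Phi_congr (s' := x) i fun l hl => ?_]
    rw [Function.update_of_ne]
    rintro rfl
    rw [SimpleGraph.dist_self, Nat.le_zero, hT.connected.dist_eq_zero_iff] at hl
    exact Finset.ne_of_mem_erase hi hl.symm
  rw [h1]
  have h2 := ((((hasDerivAt_id (x p)).mul_const (Phi T C p x p / x p)).const_mul
    (C p p)).add_const (∑ i ∈ Finset.univ.erase p, C i i * Phi T C p x i))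
  have e : C p p * Phi T C p x p / x p = C p p * (1 * (Phi T C p x p / x p)) := by ring
  rw [e]
  exact h2

/-- A function on the orthant whose partial derivatives vanish is constant. -/
theorem eq_of_partial_eq_zero {D : (V → ℝ) → ℝ} [DecidableEq V]
    (h : ∀ x ∈ orthant V, ∀ i, HasDerivAt (fun t => D (Function.update x i t)) 0 (x i))
    {x : V → ℝ} (hx : x ∈ orthant V) : D x = D 1 := by
  have hmem : ∀ x ∈ orthant V, ∀ i, ∀ t : ℝ, 0 < t → Function.update x i t ∈ orthant V := by
    intro x hx i t ht j
    by_cases hj : j = i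
    · subst hj
      simpa using ht
    · simpa [hj] using hx j
  have hone : ∀ x ∈ orthant V, ∀ i, ∀ t : ℝ, 0 < t → D (Function.update x i t) = D x := by
    intro x hx i t ht
    have hd : ∀ s ∈ Set.Ioi (0 : ℝ), HasDerivAt (fun t => D (Function.update x i t)) 0 s := by
      intro s hs
      have := h _ (hmem x hx i s hs) i
      simpa using this
    have := isOpen_Ioi.is_const_of_deriv_eq_zero isPreconnected_Ioi
      (fun s hs => (hd s hs).differentiableAt.differentiableWithinAt)
      (fun s hs => (hd s hs).deriv) (show t ∈ Set.Ioi (0 : ℝ) from ht) (hx i)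
    simpa using this
  -- Passage from `1` to `x` one coordinate at a time, inside the orthant.
  have hS : ∀ S : Finset V, D (S.piecewise x 1) = D 1 ∧ S.piecewise x 1 ∈ orthant V := by
    intro S
    induction S using Finset.induction_on with
    | empty => simp [one_mem_orthant]
    | insert i S _ ih =>
      rw [Finset.piecewise_insert]
      exact ⟨(hone _ ih.2 i _ (hx i)).trans ih.1, hmem _ ih.2 i _ (hx i)⟩
  have := (hS Finset.univ).1
  rwa [Finset.piecewise_univ] at this

/-- The logarithmic density is that of a tree-Kummer law, up to an additive constant. -/
theorem exists_log_density [DecidableRel T.Adj] (hT : T.IsTree) (hcard : 2 ≤ Fintype.card V)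
    (hC : IsParam T C) {L : (V → ℝ) → ℝ} (hL : ContDiffOn ℝ 1 L (orthant V))
    (hs : ∀ r, T.degree r = 1 → ∀ q, IsSeparable T C r q L) :
    ∃ (a : V → ℝ) (c b : ℝ), ∀ x ∈ orthant V,
      L x = b + ∑ i, a i * Real.log (x i) - c * energy T C hC.symm x := by
  classical
  obtain ⟨a, c, hg⟩ := exists_gradient hT hcard hC hL hs
  set D : (V → ℝ) → ℝ := fun x =>
    L x - (∑ i, a i * Real.log (x i) - c * energy T C hC.symm x) with hD
  refine ⟨a, c, D 1, fun x hx => ?_⟩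
  suffices D x = D 1 by
    rw [← this, hD]
    ring
  refine eq_of_partial_eq_zero (fun x hx p => ?_) hx
  have h1 := hg p x hx
  have h2 := (hasDerivAt_energy hT hC p hx).const_mul c
  have h3 : HasDerivAt (fun t => ∑ i, a i * Real.log (Function.update x p t i))
      (a p * (x p)⁻¹) (x p) := by
    have e : (fun t => ∑ i, a i * Real.log (Function.update x p t i)) = fun t =>
        a p * Real.log t + ∑ i ∈ Finset.univ.erase p, a i * Real.log (x i) := by
      funext t
      rw [← Finset.add_sum_erase _ _ (Finset.mem_univ p), Function.update_self]
      congr 1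
      refine Finset.sum_congr rfl fun i hi => ?_
      rw [Function.update_of_ne (Finset.ne_of_mem_erase hi)]
    rw [e]
    exact ((Real.hasDerivAt_log (hx p).ne').const_mul _).add_const _
  have e : (0 : ℝ) = (a p - c * (C p p * Phi T C p x p)) / x p -
      (a p * (x p)⁻¹ - c * (C p p * Phi T C p x p / x p)) := by
    have := (hx p).ne'
    field_simp
    ring
  rw [e]
  exact h1.sub (h3.sub h2)

end LogDensity

/-! ### Products of measures with densities -/

section ProductDensity

open scoped ENNReal

theorem lintegral_fin_nat_prod_eq_prod {n : ℕ} {E : Fin n → Type*}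
    {mE : ∀ i, MeasurableSpace (E i)} {μ : (i : Fin n) → Measure (E i)} [∀ i, SigmaFinite (μ i)]
    {f : (i : Fin n) → E i → ℝ≥0∞} (hf : ∀ i, Measurable (f i)) :
    ∫⁻ x : (i : Fin n) → E i, ∏ i, f i (x i) ∂(Measure.pi μ) = ∏ i, ∫⁻ x, f i x ∂(μ i) := by
  induction n with
  | zero => simp
  | succ n n_ih =>
    rw [Fin.prod_univ_succ, ← n_ih fun i => hf i.succ, ← lintegral_prod_mul (hf 0).aemeasurable
      (Finset.measurable_prod _ fun i _ =>
        (hf i.succ).comp (measurable_pi_apply i)).aemeasurable,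
      ← ((measurePreserving_piFinSuccAbove μ 0).symm).lintegral_comp_emb
        (MeasurableEquiv.measurableEmbedding _)]
    refine lintegral_congr fun x => ?_
    rw [Fin.prod_univ_succ]
    rfl

theorem lintegral_fintype_prod_eq_prod {ι : Type*} [Fintype ι] {E : ι → Type*}
    {mE : ∀ i, MeasurableSpace (E i)} {μ : (i : ι) → Measure (E i)} [∀ i, SigmaFinite (μ i)]
    {f : (i : ι) → E i → ℝ≥0∞} (hf : ∀ i, Measurable (f i)) :
    ∫⁻ x : (i : ι) → E i, ∏ i, f i (x i) ∂(Measure.pi μ) = ∏ i, ∫⁻ x, f i x ∂(μ i) := by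
  let e := (Fintype.equivFin ι).symm
  rw [← (measurePreserving_piCongrLeft _ e).lintegral_comp_emb
    (MeasurableEquiv.measurableEmbedding _)]
  simp_rw [← e.prod_comp, MeasurableEquiv.coe_piCongrLeft, Equiv.piCongrLeft_apply_apply]
  exact lintegral_fin_nat_prod_eq_prod fun i => hf _

/-- A product of measures with densities has the product density. -/
theorem pi_withDensity {ι : Type*} [Fintype ι] {E : ι → Type*}
    {mE : ∀ i, MeasurableSpace (E i)} {μ : (i : ι) → Measure (E i)} [∀ i, SigmaFinite (μ i)]
    {f : (i : ι) → E i → ℝ≥0∞} (hf : ∀ i, Measurable (f i))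
    [∀ i, SigmaFinite ((μ i).withDensity (f i))] :
    Measure.pi (fun i => (μ i).withDensity (f i)) =
      (Measure.pi μ).withDensity fun x => ∏ i, f i (x i) := by
  classical
  refine Measure.pi_eq fun s hs => ?_
  rw [withDensity_apply _ (MeasurableSet.univ_pi hs), Measure.restrict_pi_pi,
    lintegral_fintype_prod_eq_prod hf]
  exact Finset.prod_congr rfl fun i _ => (withDensity_apply _ (hs i)).symm

end ProductDensity

/-! ### Normalization -/

section Normalize

open scoped ENNReal

/-- Total mass one determines the factor `κ`, so normalizing constants need not be computed. -/
theorem smul_eq_normalize {α : Type*} [MeasurableSpace α] {κ : ℝ≥0∞} {μ : Measure α}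
    (h : IsProbabilityMeasure (κ • μ)) : κ • μ = normalize μ := by
  have h1 : κ * μ Set.univ = 1 := by
    rw [← smul_eq_mul, ← Measure.smul_apply, h.measure_univ]
  rw [normalize, ENNReal.eq_inv_of_mul_eq_one_left h1]

theorem measure_univ_ne_top_of_smul {α : Type*} [MeasurableSpace α] {κ : ℝ≥0∞} {μ : Measure α}
    (h : IsProbabilityMeasure (κ • μ)) : μ Set.univ ≠ ∞ := by
  have h1 : κ * μ Set.univ = 1 := by
    rw [← smul_eq_mul, ← Measure.smul_apply, h.measure_univ]
  intro h2
  rw [h2] at h1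
  by_cases hκ : κ = 0
  · simp [hκ] at h1
  · rw [ENNReal.mul_top hκ] at h1
    exact ENNReal.top_ne_one h1

theorem hasLaw_normalize_of_smul {Ω α : Type*} [MeasurableSpace Ω] [MeasurableSpace α]
    {P : Measure Ω} [IsProbabilityMeasure P] {X : Ω → α} {κ : ℝ≥0∞} {μ : Measure α}
    (h : HasLaw X (κ • μ) P) : HasLaw X (normalize μ) P := by
  rwa [← smul_eq_normalize (h.isProbabilityMeasure_iff.1 inferInstance)]

end Normalize

/-! ### Gamma and Kummer laws on the half-line -/

section OneDimensional

open Set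

/-- The measure on `(0, ∞)` with density `g`. -/
def halfLine (g : ℝ → ℝ) : Measure ℝ :=
  (volume.restrict (Ioi 0)).withDensity fun x => ENNReal.ofReal (g x)

theorem halfLine_congr_smul {g g' : ℝ → ℝ} {b : ℝ} (hb : 0 ≤ b)
    (h : ∀ x, 0 < x → g x = b * g' x) : halfLine g = ENNReal.ofReal b • halfLine g' := by
  rw [halfLine, halfLine, ← withDensity_smul' _ _ ENNReal.ofReal_ne_top]
  refine withDensity_congr_ae ?_
  filter_upwards [ae_restrict_mem measurableSet_Ioi] with x hx
  rw [Pi.smul_apply, smul_eq_mul, h x hx, ENNReal.ofReal_mul hb]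

theorem map_mul_halfLine {k : ℝ} (hk : 0 < k) (g : ℝ → ℝ) :
    Measure.map (fun x => k * x) (halfLine g) = halfLine fun x => k⁻¹ * g (k⁻¹ * x) := by
  classical
  have hm : Measurable fun x : ℝ => k * x := measurable_const_mul k
  have him : (fun x => k⁻¹ * x) '' Ioi (0 : ℝ) = Ioi 0 := by
    rw [image_mul_left_Ioi (inv_pos.2 hk), mul_zero]
  refine Measure.ext fun s hs => ?_
  rw [Measure.map_apply hm hs, halfLine, halfLine, withDensity_apply _ (hm hs),
    withDensity_apply _ hs, ← lintegral_indicator (hm hs), ← lintegral_indicator hs]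
  conv_lhs => rw [← him]
  rw [lintegral_image_eq_lintegral_abs_deriv_mul measurableSet_Ioi (f := fun x => k⁻¹ * x)
    (f' := fun _ => k⁻¹ * 1)
    (fun x _ => ((hasDerivAt_id x).const_mul k⁻¹).hasDerivWithinAt)
    (fun x _ y _ h => mul_left_cancel₀ (inv_pos.2 hk).ne' h)]
  refine lintegral_congr fun x => ?_
  have e : k * (k⁻¹ * x) = x := by field_simp
  simp only [mul_one, abs_of_pos (inv_pos.2 hk), indicator, mem_preimage, e]
  split_ifs
  · rw [← ENNReal.ofReal_mul (inv_pos.2 hk).le]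
  · rw [mul_zero]

/-- If the gamma density with parameters `a`, `b` is integrable then both are positive. -/
theorem pos_of_gamma_finite {a b : ℝ}
    (h : halfLine (fun x => x ^ (a - 1) * Real.exp (-(b * x))) univ ≠ ⊤) : 0 < a ∧ 0 < b := by
  have hint : IntegrableOn (fun x : ℝ => x ^ (a - 1) * Real.exp (-(b * x))) (Ioi 0) := by
    rw [halfLine, withDensity_apply _ MeasurableSet.univ, Measure.restrict_univ] at h
    refine ⟨by fun_prop, ?_⟩
    rw [hasFiniteIntegral_iff_ofReal]
    · exact h.lt_top
    · filter_upwards [ae_restrict_mem measurableSet_Ioi] with x hx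
      have hx : 0 < x := hx
      positivity
  have ha : 0 < a := by
    have h1 : IntegrableOn (fun x : ℝ => x ^ (a - 1)) (Ioo 0 1) := by
      have h2 := (hint.mono_set (Ioo_subset_Ioi_self : Ioo (0 : ℝ) 1 ⊆ Ioi 0)).const_mul (Real.exp |b|)
      refine h2.mono' (by fun_prop) ?_
      filter_upwards [ae_restrict_mem measurableSet_Ioo] with x hx
      have hx0 : 0 < x := hx.1
      rw [Real.norm_of_nonneg (by positivity)]
      -- On `(0, 1)` the factor `exp |b|` compensates the exponential whatever the sign of `b`.
      have h3 : 1 ≤ Real.exp |b| * Real.exp (-(b * x)) := by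
        rw [← Real.exp_add]
        refine Real.one_le_exp ?_
        have h4 : b * x ≤ |b| * x := mul_le_mul_of_nonneg_right (le_abs_self b) hx0.le
        have h5 : |b| * x ≤ |b| * 1 := mul_le_mul_of_nonneg_left hx.2.le (abs_nonneg b)
        linarith
      have h6 : 0 < x ^ (a - 1) := by positivity
      calc x ^ (a - 1) = x ^ (a - 1) * 1 := (mul_one _).symm
        _ ≤ x ^ (a - 1) * (Real.exp |b| * Real.exp (-(b * x))) :=
          mul_le_mul_of_nonneg_left h3 h6.le
        _ = Real.exp |b| * (x ^ (a - 1) * Real.exp (-(b * x))) := by ring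
    rw [intervalIntegral.integrableOn_Ioo_rpow_iff one_pos] at h1
    linarith
  refine ⟨ha, ?_⟩
  by_contra hb
  push Not at hb
  -- For `b ≤ 0` the exponential is at least `1`, so this power would be integrable at infinity,
  -- which requires `a < 0`.
  have h1 : IntegrableOn (fun x : ℝ => x ^ (a - 1)) (Ioi 1) := by
    have h2 := hint.mono_set (Ioi_subset_Ioi (zero_le_one (α := ℝ)))
    refine h2.mono' (by fun_prop) ?_
    filter_upwards [ae_restrict_mem measurableSet_Ioi] with x hx
    have hx0 : 0 < x := zero_lt_one.trans hx
    rw [Real.norm_of_nonneg (by positivity)]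
    have h3 : 1 ≤ Real.exp (-(b * x)) := by
      refine Real.one_le_exp ?_
      nlinarith
    have h6 : 0 < x ^ (a - 1) := by positivity
    exact le_mul_of_one_le_right h6.le h3
  rw [integrableOn_Ioi_rpow_iff one_pos] at h1
  linarith

theorem gammaMeasure_eq_normalize {a b : ℝ} (ha : 0 < a) (hb : 0 < b) :
    gammaMeasure a b = normalize (halfLine fun x => x ^ (a - 1) * Real.exp (-(b * x))) := by
  have hΓ := Real.Gamma_pos_of_pos ha
  have h : gammaMeasure a b = ENNReal.ofReal (b ^ a / Real.Gamma a) •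
      halfLine fun x => x ^ (a - 1) * Real.exp (-(b * x)) := by
    rw [← halfLine_congr_smul (g := fun x => b ^ a / Real.Gamma a * x ^ (a - 1) *
      Real.exp (-(b * x))) (by positivity) (fun x _ => by ring), halfLine,
      ← restrict_withDensity measurableSet_Ioi, gammaMeasure]
    have hz : volume.withDensity (gammaPDF a b) (Ioi 0)ᶜ = 0 := by
      rw [compl_Ioi, withDensity_apply _ measurableSet_Iic, setLIntegral_congr Iio_ae_eq_Iic.symm]
      exact lintegral_gammaPDF_of_nonpos le_rfl
    rw [← Measure.restrict_eq_self_of_ae_mem (s := Ioi 0) (μ := volume.withDensity (gammaPDF a b))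
      (mem_ae_iff.2 hz), restrict_withDensity measurableSet_Ioi,
      restrict_withDensity measurableSet_Ioi]
    refine withDensity_congr_ae ?_
    filter_upwards [ae_restrict_mem measurableSet_Ioi] with x hx
    exact gammaPDF_of_nonneg (le_of_lt hx)
  have := isProbabilityMeasure_gammaMeasure ha hb
  rw [h] at this ⊢
  exact smul_eq_normalize this

/-- The constant collects the Jacobian `k⁻¹` and the factor from `x ^ (a - 1)`. The exponent is left
as `a + (a' - a)` to match `kummerMeasure` with `β = a' - a`. -/
theorem map_mul_kummer {k a a' b : ℝ} (hk : 0 < k) :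
    Measure.map (fun x => k * x)
      (halfLine fun x => x ^ (a - 1) * Real.exp (-(b * x)) / (1 + k * x) ^ a') =
      ENNReal.ofReal (k⁻¹ ^ a) • halfLine fun x =>
        x ^ (a - 1) / (1 + x) ^ (a + (a' - a)) * Real.exp (-(b / k * x)) := by
  rw [map_mul_halfLine hk]
  refine halfLine_congr_smul (by positivity) fun x hx => ?_
  have e1 : k * (k⁻¹ * x) = x := by field_simp
  have e2 : (k⁻¹) ^ a = k⁻¹ * k⁻¹ ^ (a - 1) := by
    rw [Real.rpow_sub_one (by positivity)]
    field_simp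
  rw [e1, e2, Real.mul_rpow (by positivity) hx.le, add_sub_cancel]
  have e3 : b * (k⁻¹ * x) = b / k * x := by ring
  rw [e3]
  ring

end OneDimensional

/-! ### From independence to the density and the component laws -/

section Characterization

variable {V : Type*} [Fintype V] {T : SimpleGraph V} {C : Matrix V V ℝ}

theorem IsParam.smul (hC : IsParam T C) {c : ℝ} (hc : 0 < c) : IsParam T (c • C) where
  symm := hC.symm.smul c
  diag_pos i := mul_pos hc (hC.diag_pos i)
  edge_pos i j h := mul_pos hc (hC.edge_pos i j h)
  eq_zero i j h h' := by
    rw [Matrix.smul_apply, hC.eq_zero i j h h', smul_zero]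

theorem Phi_smul {c : ℝ} (hc : c ≠ 0) (r : V) (s : V → ℝ) (i : V) :
    Phi T (c • C) r s i = Phi T C r s i := by
  refine children_induction (T := T) r (P := fun i => Phi T (c • C) r s i = Phi T C r s i) ?_ i
  intro i ih
  rw [Phi_eq, Phi_eq T C, Finset.prod_congr rfl fun j hj => by
    rw [ih j hj, Matrix.smul_apply, Matrix.smul_apply, smul_eq_mul, smul_eq_mul,
      mul_div_mul_left _ _ hc]]

/-- `Phi` involves only ratios of entries, so in `∑ i, C i i * Phi T C r x i` only the diagonal
entries scale. -/
theorem energy_smul (hT : T.IsTree) (hC : IsParam T C) {c : ℝ} (hc : 0 < c) (x : V → ℝ) :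
    energy T (c • C) (hC.symm.smul c) x = c * energy T C hC.symm x := by
  obtain ⟨r⟩ := hT.connected.nonempty
  rw [energy_eq_sum_Phi hT hC r, energy_eq_sum_Phi hT (hC.smul hc) r, Finset.mul_sum]
  refine Finset.sum_congr rfl fun i _ => ?_
  rw [Phi_smul hc.ne', Matrix.smul_apply, smul_eq_mul, mul_assoc]

/-- Independence of the transformed coordinates makes the logarithmic density separable. -/
theorem isSeparable_of_iIndepFun (hC : IsParam T C) {Ω : Type*} [MeasurableSpace Ω]
    {P : Measure Ω} [IsProbabilityMeasure P] {X : Ω → V → ℝ} {f : (V → ℝ) → ℝ}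
    (hf_pos : ∀ x ∈ orthant V, 0 < f x) (hf : ContinuousOn f (orthant V))
    (hX : HasLaw X ((volume.restrict (orthant V)).withDensity
      fun x => ENNReal.ofReal (f x)) P) {r : V}
    (hr : iIndepFun (fun (i : V) (ω : Ω) => Phi T C r (X ω) i) P) (q : V) :
    IsSeparable T C r q fun x => Real.log (f x) + ∑ i, Real.log (x i) := by
  classical
  have hm : Measurable (Phi T C r) := (continuous_Phi r).measurable
  have hae : ∀ i, AEMeasurable (fun ω => Phi T C r (X ω) i) P := fun i =>
    ((measurable_pi_apply i).comp hm).comp_aemeasurable hX.aemeasurable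
  have hprob : ∀ i, IsProbabilityMeasure (P.map fun ω => Phi T C r (X ω) i) := fun i =>
    Measure.isProbabilityMeasure_map (hae i)
  have hlaw : (volume.restrict (orthant V)).withDensity
      (fun y => ENNReal.ofReal (f (Psi T C r y) * ∏ i, Psi T C r y i / y i)) =
      Measure.pi fun i => P.map fun ω => Phi T C r (X ω) i := by
    rw [← map_Phi_withDensity hC r f, ← hX.map_eq,
      AEMeasurable.map_map_of_aemeasurable hm.aemeasurable hX.aemeasurable]
    exact (iIndepFun_iff_map_fun_eq_pi_map hae).1 hr
  have hΨ : ContinuousOn (Psi T C r) (orthant V) := (contDiffOn_Psi hC r).continuousOn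
  have hratio : ∀ y ∈ orthant V, 0 < ∏ i, Psi T C r y i / y i := fun y hy =>
    Finset.prod_pos fun i _ => div_pos (Psi_mem_orthant hC r hy i) (hy i)
  have hpos : ∀ y ∈ orthant V, 0 < f (Psi T C r y) * ∏ i, Psi T C r y i / y i := fun y hy =>
    mul_pos (hf_pos _ (Psi_mem_orthant hC r hy)) (hratio y hy)
  have hcont : ContinuousOn (fun y => f (Psi T C r y) * ∏ i, Psi T C r y i / y i)
      (orthant V) := by
    refine (hf.comp hΨ fun y hy => Psi_mem_orthant hC r hy).mul
      (continuousOn_finsetProd _ fun i _ => ?_)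
    exact ((continuous_apply i).comp_continuousOn hΨ).div (continuous_apply i).continuousOn
      fun y hy => (hy i).ne'
  have hlog : ∀ y ∈ orthant V, Real.log (f (Psi T C r y) * ∏ i, Psi T C r y i / y i) =
      Real.log (f (Psi T C r y)) + ∑ i, Real.log (Psi T C r y i) - ∑ i, Real.log (y i) := by
    intro y hy
    rw [Real.log_mul (hf_pos _ (Psi_mem_orthant hC r hy)).ne' (hratio y hy).ne',
      Real.log_prod fun i _ => (div_pos (Psi_mem_orthant hC r hy i) (hy i)).ne',
      Finset.sum_congr rfl fun i _ => Real.log_div (Psi_mem_orthant hC r hy i).ne' (hy i).ne',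
      Finset.sum_sub_distrib]
    ring
  intro y hy y' hy'
  have hz := exchange_mem_orthant q (show (y, y') ∈ orthant V ×ˢ orthant V from ⟨hy, hy'⟩)
  have hz1 : Function.update y q (y' q) ∈ orthant V := hz.1
  have hz2 : Function.update y' q (y q) ∈ orthant V := hz.2
  have key := congrArg Real.log (density_exchange hpos hcont _ hlaw q hy hy')
  rw [Real.log_mul (hpos y hy).ne' (hpos y' hy').ne', Real.log_mul (hpos _ hz1).ne'
    (hpos _ hz2).ne', hlog y hy, hlog y' hy', hlog _ hz1, hlog _ hz2] at key
  -- The part `∏ y i` of the Jacobian is itself separable and cancels; the part `∏ Psi i` is the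
  -- reason for the term `∑ log x_i` in `L`.
  have hsum : ∑ i, Real.log (y i) + ∑ i, Real.log (y' i) =
      ∑ i, Real.log (Function.update y q (y' q) i) +
        ∑ i, Real.log (Function.update y' q (y q) i) := by
    rw [← Finset.sum_add_distrib, ← Finset.sum_add_distrib]
    refine Finset.sum_congr rfl fun i _ => ?_
    by_cases h : i = q
    · subst h
      simp [add_comm]
    · simp [h]
  linarith

open Classical in
/-- The (unnormalized) density of the coordinate `i` of `Phi T C r X` for a tree-Kummer vector. -/
def componentDensity (T : SimpleGraph V) (C : Matrix V V ℝ) (a : V → ℝ) (c : ℝ) (r i : V)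
    (t : ℝ) : ℝ :=
  t ^ (a i - 1) * Real.exp (-(c * C i i * t)) /
    ∏ p ∈ Finset.univ.filter (IsParent T r · i), (1 + C p i / C p p * t) ^ a p

theorem componentDensity_root (a : V → ℝ) (c : ℝ) (r : V) :
    componentDensity T C a c r r = fun t => t ^ (a r - 1) * Real.exp (-(c * C r r * t)) := by
  classical
  funext t
  rw [componentDensity, Finset.filter_false_of_mem, Finset.prod_empty, div_one]
  intro p _ hp
  have := hp.2
  simp at this

theorem componentDensity_of_isParent (hT : T.IsTree) (a : V → ℝ) (c : ℝ) {r i j : V}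
    (h : IsParent T r j i) : componentDensity T C a c r i = fun t =>
      t ^ (a i - 1) * Real.exp (-(c * C i i * t)) / (1 + C j i / C j j * t) ^ a j := by
  classical
  funext t
  have : Finset.univ.filter (IsParent T r · i) = {j} := by
    ext p
    simp only [Finset.mem_filter, Finset.mem_univ, true_and, Finset.mem_singleton]
    exact ⟨fun hp => hp.eq_left hT h, fun hp => hp ▸ h⟩
  rw [componentDensity, this, Finset.prod_singleton]

theorem measurable_componentDensity (a : V → ℝ) (c : ℝ) (r i : V) :
    Measurable (componentDensity T C a c r i) := by
  unfold componentDensity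
  fun_prop

theorem componentDensity_nonneg (hC : IsParam T C) (a : V → ℝ) (c : ℝ) (r i : V) {t : ℝ}
    (ht : 0 < t) : 0 ≤ componentDensity T C a c r i t := by
  classical
  refine div_nonneg (by positivity) (Finset.prod_nonneg fun p hp => ?_)
  have := coeff_pos hC (Finset.mem_filter.1 hp).2.1
  positivity

/-- In the transformed coordinates the tree-Kummer density is a product. -/
theorem density_Psi (hT : T.IsTree) (hC : IsParam T C) (a : V → ℝ) (c : ℝ) (r : V) {y : V → ℝ}
    (hy : y ∈ orthant V) :
    ((∏ i, Psi T C r y i ^ (a i - 1)) * Real.exp (-(c * energy T C hC.symm (Psi T C r y)))) *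
      ∏ i, Psi T C r y i / y i = ∏ i, componentDensity T C a c r i (y i) := by
  classical
  have hD : ∀ i, 0 < ∏ j ∈ children T r i, (1 + C i j / C i i * y j) := fun i =>
    prod_children_pos hC hy
  have h1 : ∀ i, Psi T C r y i ^ (a i - 1) * (Psi T C r y i / y i) =
      y i ^ (a i - 1) / ∏ j ∈ children T r i, (1 + C i j / C i i * y j) ^ a i := by
    intro i
    have hyi := hy i
    rw [Real.finsetProd_rpow _ _ fun j hj => by
      have := coeff_pos hC (mem_children.1 hj).1
      have := hy j
      positivity, Psi]
    have hDi := hD i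
    generalize ∏ j ∈ children T r i, (1 + C i j / C i i * y j) = d at hDi
    rw [Real.div_rpow hyi.le hDi.le, Real.rpow_sub_one hDi.ne']
    field_simp
  -- The factor of each edge moves from the parent to the child, whose coordinate is the only one it
  -- contains.
  have h2 : ∏ i, ∏ j ∈ children T r i, (1 + C i j / C i i * y j) ^ a i =
      ∏ j, ∏ i ∈ Finset.univ.filter (IsParent T r · j), (1 + C i j / C i i * y j) ^ a i :=
    Finset.prod_comm' fun i j => by simp [mem_children]
  have h3 : Real.exp (-(c * energy T C hC.symm (Psi T C r y))) =
      ∏ i, Real.exp (-(c * C i i * y i)) := by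
    rw [energy_eq_sum_Phi hT hC r, Phi_Psi hC r hy, ← Real.exp_sum, Finset.sum_neg_distrib,
      Finset.mul_sum]
    simp only [mul_assoc]
  calc _ = (∏ i, Psi T C r y i ^ (a i - 1) * (Psi T C r y i / y i)) *
        Real.exp (-(c * energy T C hC.symm (Psi T C r y))) := by
        rw [Finset.prod_mul_distrib]
        ring
    _ = _ := by
        rw [Finset.prod_congr rfl fun i _ => h1 i, Finset.prod_div_distrib, h2, h3]
        simp only [componentDensity, Finset.prod_div_distrib, Finset.prod_mul_distrib]
        ring

instance sigmaFinite_halfLine (g : ℝ → ℝ) : SigmaFinite (halfLine g) :=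
  SigmaFinite.withDensity_ofReal _

/-- The product of the component laws, as a density on the orthant. -/
theorem pi_halfLine (hC : IsParam T C) (a : V → ℝ) (c : ℝ) (r : V) :
    Measure.pi (fun i => halfLine (componentDensity T C a c r i)) =
      (volume.restrict (orthant V)).withDensity fun y =>
        ENNReal.ofReal (∏ i, componentDensity T C a c r i (y i)) := by
  have : ∀ i, SigmaFinite ((volume.restrict (Set.Ioi (0 : ℝ))).withDensity
      fun x => ENNReal.ofReal (componentDensity T C a c r i x)) := fun i =>
    sigmaFinite_halfLine _
  have h := pi_withDensity (μ := fun _ : V => volume.restrict (Set.Ioi (0 : ℝ)))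
    (f := fun i x => ENNReal.ofReal (componentDensity T C a c r i x))
    fun i => (measurable_componentDensity a c r i).ennreal_ofReal
  rw [← restrict_orthant_eq_pi] at h
  refine h.trans (withDensity_congr_ae ?_)
  filter_upwards [ae_restrict_mem measurableSet_orthant] with y hy
  rw [ENNReal.ofReal_prod_of_nonneg fun i _ => componentDensity_nonneg hC a c r i (hy i)]

/-- The laws of the transformed coordinates of a vector with a density of tree-Kummer form. -/
theorem hasLaw_component (hT : T.IsTree) (hC : IsParam T C) {Ω : Type*} [MeasurableSpace Ω]
    {P : Measure Ω} {X : Ω → V → ℝ} {f : (V → ℝ) → ℝ} {a : V → ℝ} {b c : ℝ}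
    (hf : ∀ x ∈ orthant V, f x = Real.exp b *
      ((∏ i, x i ^ (a i - 1)) * Real.exp (-(c * energy T C hC.symm x))))
    (hX : HasLaw X ((volume.restrict (orthant V)).withDensity
      fun x => ENNReal.ofReal (f x)) P) (r i : V) :
    ∃ κ : ENNReal, HasLaw (fun ω => Phi T C r (X ω) i) (κ • halfLine (componentDensity T C a c r i)) P := by
  classical
  have hm : Measurable (Phi T C r) := (continuous_Phi r).measurable
  have h1 : HasLaw (Phi T C r) (ENNReal.ofReal (Real.exp b) •
      Measure.pi fun i => halfLine (componentDensity T C a c r i))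
      ((volume.restrict (orthant V)).withDensity fun x => ENNReal.ofReal (f x)) := by
    refine ⟨hm.aemeasurable, ?_⟩
    rw [map_Phi_withDensity hC r f, pi_halfLine hC, ← withDensity_smul' _ _ ENNReal.ofReal_ne_top]
    refine withDensity_congr_ae ?_
    filter_upwards [ae_restrict_mem measurableSet_orthant] with y hy
    rw [hf _ (Psi_mem_orthant hC r hy), mul_assoc, density_Psi hT hC a c r hy, Pi.smul_apply,
      smul_eq_mul, ENNReal.ofReal_mul (Real.exp_pos b).le]
  -- Projecting a product measure to one coordinate multiplies that factor by the total masses of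
  -- the others.
  refine ⟨ENNReal.ofReal (Real.exp b) * ∏ j ∈ Finset.univ.erase i,
    halfLine (componentDensity T C a c r j) Set.univ, ?_⟩
  have h2 : HasLaw (Function.eval i) ((ENNReal.ofReal (Real.exp b) * ∏ j ∈ Finset.univ.erase i,
      halfLine (componentDensity T C a c r j) Set.univ) • halfLine (componentDensity T C a c r i))
      (ENNReal.ofReal (Real.exp b) •
        Measure.pi fun i => halfLine (componentDensity T C a c r i)) := by
    refine ⟨(measurable_pi_apply i).aemeasurable, ?_⟩
    rw [Measure.map_smul, Measure.pi_map_eval, smul_smul]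
  exact h2.comp (h1.comp hX)

/-- Rescaling a variable with an unnormalized Kummer density. -/
theorem hasLaw_kummer {Ω : Type*} [MeasurableSpace Ω] {P : Measure Ω} [IsProbabilityMeasure P]
    {Z : Ω → ℝ} {κ : ENNReal} {k a a' b : ℝ} (hk : 0 < k)
    (hZ : HasLaw Z (κ • halfLine fun x =>
      x ^ (a - 1) * Real.exp (-(b * x)) / (1 + k * x) ^ a') P) :
    HasLaw (fun ω => k * Z ω) (kummerMeasure a (a' - a) (b / k)) P := by
  refine hasLaw_normalize_of_smul (κ := κ * ENNReal.ofReal (k⁻¹ ^ a)) ?_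
  have h : HasLaw (fun x => k * x) ((κ * ENNReal.ofReal (k⁻¹ ^ a)) • halfLine fun x =>
      x ^ (a - 1) / (1 + x) ^ (a + (a' - a)) * Real.exp (-(b / k * x))) (κ • halfLine fun x =>
      x ^ (a - 1) * Real.exp (-(b * x)) / (1 + k * x) ^ a') := by
    refine ⟨(measurable_const_mul k).aemeasurable, ?_⟩
    rw [Measure.map_smul, map_mul_kummer hk, smul_smul]
  exact h.comp hZ

/-- The density is of tree-Kummer form. -/
theorem exists_density [DecidableRel T.Adj] (hT : T.IsTree) (hcard : 2 ≤ Fintype.card V)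
    (hC : IsParam T C) {Ω : Type*} [MeasurableSpace Ω] {P : Measure Ω} [IsProbabilityMeasure P]
    {X : Ω → V → ℝ} {f : (V → ℝ) → ℝ} (hf_pos : ∀ x ∈ orthant V, 0 < f x)
    (hf_smooth : ContDiffOn ℝ 1 f (orthant V))
    (hX : HasLaw X ((volume.restrict (orthant V)).withDensity
      fun x => ENNReal.ofReal (f x)) P)
    (hindep : ∀ r : V, T.degree r = 1 →
      iIndepFun (fun (i : V) (ω : Ω) => Phi T C r (X ω) i) P) :
    ∃ (a : V → ℝ) (b c : ℝ), ∀ x ∈ orthant V, f x = Real.exp b *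
      ((∏ i, x i ^ (a i - 1)) * Real.exp (-(c * energy T C hC.symm x))) := by
  have hL : ContDiffOn ℝ 1 (fun x => Real.log (f x) + ∑ i, Real.log (x i)) (orthant V) := by
    refine (hf_smooth.log fun x hx => (hf_pos x hx).ne').add (ContDiffOn.sum fun i _ => ?_)
    exact (contDiff_apply ℝ ℝ i).contDiffOn.log fun x hx => (hx i).ne'
  obtain ⟨a, c, b, h⟩ := exists_log_density hT hcard hC hL fun r hr q =>
    isSeparable_of_iIndepFun hC hf_pos hf_smooth.continuousOn hX (hindep r hr) q
  refine ⟨a, b, c, fun x hx => ?_⟩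
  have h1 := h x hx
  -- Returning from `L` to `log f` subtracts `∑ log x_i`, hence the exponents `a i - 1`.
  have h2 : ∏ i, x i ^ (a i - 1) = Real.exp (∑ i, (a i * Real.log (x i) - Real.log (x i))) := by
    rw [Real.exp_sum]
    refine Finset.prod_congr rfl fun i _ => ?_
    rw [Real.rpow_def_of_pos (hx i)]
    congr 1
    ring
  rw [h2, ← Real.exp_add, ← Real.exp_add, ← Real.exp_log (hf_pos x hx),
    Finset.sum_sub_distrib]
  congr 1
  linarith

end Characterization

end TreeKummer

end

/-! ### The characterization theorem -/

theorem theorem4p2 {V : Type*} [Fintype V] (T : SimpleGraph V) [DecidableRel T.Adj]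
    (hT : T.IsTree) (hcard : 2 ≤ Fintype.card V)
    (C : Matrix V V ℝ) (hC : TreeKummer.IsParam T C)
    {Ω : Type*} [MeasurableSpace Ω] (P : Measure Ω) [IsProbabilityMeasure P]
    (X : Ω → V → ℝ) (f : (V → ℝ) → ℝ)
    (hf_pos : ∀ x ∈ TreeKummer.orthant V, 0 < f x)
    (hf_smooth : ContDiffOn ℝ 1 f (TreeKummer.orthant V))
    (hX : HasLaw X ((volume.restrict (TreeKummer.orthant V)).withDensity
      fun x => ENNReal.ofReal (f x)) P)
    (hindep : ∀ r : V, T.degree r = 1 →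
      iIndepFun (fun (i : V) (ω : Ω) => TreeKummer.Phi T C r (X ω) i) P) :
    ∃ (a : V → ℝ) (c : ℝ), (∀ i, 0 < a i) ∧ 0 < c ∧
      (∀ r : V,
        HasLaw (fun ω => TreeKummer.Phi T C r (X ω) r) (gammaMeasure (a r) (c * C r r)) P ∧
        ∀ i j : V, TreeKummer.IsParent T r j i →
          HasLaw (fun ω => C j i / C j j * TreeKummer.Phi T C r (X ω) i)
            (TreeKummer.kummerMeasure (a i) (a j - a i) (c * (C j j * C i i / C j i))) P) ∧
      HasLaw X (TreeKummer.treeKummerMeasure T a (c • C) (hC.symm.smul c)) P := by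
  obtain ⟨a, b, c, hf⟩ := TreeKummer.exists_density hT hcard hC hf_pos hf_smooth hX hindep
  have hcomp := TreeKummer.hasLaw_component hT hC hf hX
  have hroot : ∀ r, ∃ κ : ENNReal, HasLaw (fun ω => TreeKummer.Phi T C r (X ω) r)
      (κ • TreeKummer.halfLine fun t => t ^ (a r - 1) * Real.exp (-(c * C r r * t))) P := by
    intro r
    obtain ⟨κ, h⟩ := hcomp r r
    rw [TreeKummer.componentDensity_root] at h
    exact ⟨κ, h⟩
  -- Once the density is known every vertex may serve as root, not only leaves. The root coordinate
  -- has a gamma-type density, whose finite mass forces both signs.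
  have hpos : ∀ r, 0 < a r ∧ 0 < c * C r r := fun r => by
    obtain ⟨κ, h⟩ := hroot r
    exact TreeKummer.pos_of_gamma_finite (TreeKummer.measure_univ_ne_top_of_smul
      (h.isProbabilityMeasure_iff.1 inferInstance))
  have hc : 0 < c := by
    obtain ⟨r⟩ := hT.connected.nonempty
    exact pos_of_mul_pos_left (hpos r).2 (hC.diag_pos r).le
  refine ⟨a, c, fun i => (hpos i).1, hc, fun r => ⟨?_, fun i j hij => ?_⟩, ?_⟩
  · obtain ⟨κ, h⟩ := hroot r
    rw [TreeKummer.gammaMeasure_eq_normalize (hpos r).1 (hpos r).2]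
    exact TreeKummer.hasLaw_normalize_of_smul h
  · obtain ⟨κ, h⟩ := hcomp r i
    have hk := TreeKummer.coeff_pos hC hij.1
    rw [TreeKummer.componentDensity_of_isParent hT a c hij] at h
    have e : c * (C j j * C i i / C j i) = c * C i i / (C j i / C j j) := by
      have := hC.diag_pos j
      have := hC.edge_pos j i hij.1
      field_simp
    rw [e]
    exact TreeKummer.hasLaw_kummer hk h
  · refine TreeKummer.hasLaw_normalize_of_smul (κ := ENNReal.ofReal (Real.exp b)) ?_
    rw [← withDensity_smul' _ _ ENNReal.ofReal_ne_top]
    refine ⟨hX.aemeasurable, hX.map_eq.trans (withDensity_congr_ae ?_)⟩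
    filter_upwards [ae_restrict_mem TreeKummer.measurableSet_orthant] with x hx
    rw [hf x hx, Pi.smul_apply, smul_eq_mul, ← ENNReal.ofReal_mul (Real.exp_pos b).le,
      TreeKummer.energy_smul hT hC hc]
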